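/- \textbf{Notation.} Let $N\ge 0$ be an integer and $\gamma\in\mathbb R$. Put $\mathbb R^N_{\rm reg}=\{\bm x\in\mathbb R^N: x_j\ne x_k \text{ for } j\neq k\}$ and $\mathbb R^N_+=\{\bm x: x_1>\dots>x_N\}$. The symmetric group $S_N$ acts on vectors by $(w\bm x)_j=x_{w^{-1}(j)}$ and on functions by $(wf)(\bm x)=f(w^{-1}\bm x)$. For $1\le j<N$ let $s_j$ be the transposition of $j,j+1$ and, for $f$ smooth on $\mathbb R^N$, put \[ (s_{j,\gamma}f)(\bm x)=f(s_j\bm x)+\gamma\int_0^{x_j-x_{j+1}} f\bigl(\bm x-y(\bm e_j-\bm e_{j+1})\bigr)\,dy . \] For $w=s_{i_1}\cdots s_{i_l}\in S_N$ put $w_\gamma=s_{i_1,\gamma}\cdots s_{i_l,\gamma}$ (this does not depend on the decomposition). For $\bm\lambda\in\mathbb C^N$ the \emph{pre-wavefunction} $\psi_{\bm\lambda}:\mathbb R^N\to\mathbb C$ is the continuous extension to $\mathbb R^N$ of the function on $\mathbb R^N_{\rm reg}$ given by \[ \sum_{w\in S_N}\chi_{w^{-1}\mathbb R^N_+}\,w^{-1}w_\gamma\,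 e^{i\bm\lambda},\qquad e^{i\bm\lambda}(\bm x)=e^{i\sum_j\lambda_jx_j} , \] where $\chi_X$ is the characteristic function of $X$. For $0\le n\le N$ let $\mathfrak i^n_N$ be the set of $n$-tuples $\bm i=(i_1,\dots,i_n)$ of distinct elements of $\{1,\dots,N\}$. For $\bm i\in\mathfrak i_N^n$ and $\bm x\in\mathbb R^N$ let $\bm x_{\bm i\to\bm y}$ be $\bm x$ with $x_{i_m}$ replaced by $y_m$ ($m=1,\dots,n$). Let $\theta(z_1>\dots>z_k)$ be $1$ if these inequalities hold and $0$ otherwise. For $\mu\in\mathbb C$, $L>0$ and $f\in\mathcal C(\mathbb R^N)$ define, with $z_m=x_{i_m}$ in the formulas for $b^-_\mu,a_\mu,d_\mu$ and $z_m=x_{i_m+1}$ in the one for $b^+_\mu$, \begin{align*} (b^-_\mu f)(\bm x)&=e^{i\mu x_{N+1}}\sum_{n=0}^N\gamma^n\sum_{\bm i\in\mathfrak i^n_N}\theta(z_0>z_1>\dots>z_n)\Bigl(\prod_{m=1}^n\int_{z_m}^{z_{m-1}}dy_m\,e^{i\mu(z_m-y_m)}\Bigr) f\bigl((x_1,\dots,x_N)_{\bm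 i\to\bm y}\bigr),\quad z_0=x_{N+1},\\ (b^+_\mu f)(\bm x)&=e^{i\mu x_{1}}\sum_{n=0}^N\gamma^n\sum_{\bm i\in\mathfrak i^n_N}\theta(z_1>\dots>z_n>z_{n+1})\Bigl(\prod_{m=1}^n\int_{z_{m+1}}^{z_{m}}dy_m\,e^{i\mu(z_m-y_m)}\Bigr) f\bigl((x_2,\dots,x_{N+1})_{\bm i\to\bm y}\bigr),\quad z_{n+1}=x_{1}, \end{align*} for $\bm x\in\mathbb R^{N+1}$, and, for $\bm x\in[-L/2,L/2]^N$, \begin{align*} (a_\mu f)(\bm x)&=e^{-i\mu L/2}\sum_{n=0}^N\gamma^n\sum_{\bm i\in\mathfrak i^n_N}\theta(z_1>\dots>z_n)\Bigl(\prod_{m=1}^n\int_{z_{m+1}}^{z_{m}}dy_m\,e^{i\mu(z_m-y_m)}\Bigr) f(\bm x_{\bm i\to\bm y}),\quad z_{n+1}=-L/2,\\ (d_\mu f)(\bm x)&=e^{i\mu L/2}\sum_{n=0}^N\gamma^n\sum_{\bm i\in\mathfrak i^n_N}\theta(z_1>\dots>z_n)\Bigl(\prod_{m=1}^n\int_{z_m}^{z_{m-1}}dy_m\,e^{i\mu(z_m-y_m)}\Bigr)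 f(\bm x_{\bm i\to\bm y}),\quad z_{0}=L/2. \end{align*} Finally let $\displaystyle\tau^\pm_\mu(\bm\lambda)=\prod_{j=1}^N\frac{\lambda_j-\mu\mp i\gamma}{\lambda_j-\mu}$. \textbf{Proposition.} Let $\gamma\in\mathbb R$, $\bm\lambda\in\mathbb R^N_{\rm reg}$ and $\mu\in\mathbb C\setminus\{\lambda_1,\dots,\lambda_N\}$. Then \[ b^-_\mu\psi_{\bm\lambda}=\psi_{\bm\lambda,\mu}\in\mathcal C(\mathbb R^{N+1}),\qquad b^+_\mu\psi_{\bm\lambda}=\psi_{\mu,\bm\lambda}\in\mathcal C(\mathbb R^{N+1}), \] where $\psi_{\bm\lambda,\mu}$ and $\psi_{\mu,\bm\lambda}$ are the pre-wavefunctions in $N+1$ variables with parameters $(\lambda_1,\dots,\lambda_N,\mu)$ and $(\mu,\lambda_1,\dots,\lambda_N)$. Moreover, for every $\bm x\in\mathbb R^N$, \begin{align*} \lim_{L\to\infty}e^{i\mu L/2}(a_\mu\psi_{\bm\lambda})(\bm x)&=\tau^+_\mu(\bm\lambda)\,\psi_{\bm\lambda}(\bm x)&&\text{if }\operatorname{Im}\mu>0,\\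 \lim_{L\to\infty}e^{-i\mu L/2}(d_\mu\psi_{\bm\lambda})(\bm x)&=\tau^-_\mu(\bm\lambda)\,\psi_{\bm\lambda}(\bm x)&&\text{if }\operatorname{Im}\mu<0. \end{align*} -/

import Mathlib

open Filter Topology

noncomputable section

namespace QNLS

/-! Points of `ℝ^N` are functions `Fin N → ℝ` and functions of `N` variables are plain functions
`(Fin N → ℝ) → ℂ`. Coordinates are numbered from `0`. -/

/-- The set of regular vectors: all coordinates are distinct. -/
def regularVectors (N : ℕ) : Set (Fin N → ℝ) := {x | Function.Injective x}

/-- The fundamental alcove `x_1 > ... > x_N`. -/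
def fundamentalAlcove (N : ℕ) : Set (Fin N → ℝ) := {x | StrictAnti x}

/-- The left action of the symmetric group on vectors, `(w x)_j = x_{w⁻¹ j}`. -/
def permVec {N : ℕ} (w : Equiv.Perm (Fin N)) (x : Fin N → ℝ) : Fin N → ℝ :=
  fun j => x (w⁻¹ j)

/-- The left action of the symmetric group on functions, `(w f)(x) = f (w⁻¹ x)`. -/
def permFun {N : ℕ} (w : Equiv.Perm (Fin N)) (f : (Fin N → ℝ) → ℂ) : (Fin N → ℝ) → ℂ :=
  fun x => f (permVec w⁻¹ x)

/-- The first of the two adjacent positions labelled by `j`. -/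
def leftPos {N : ℕ} (j : Fin (N - 1)) : Fin N := ⟨j, by omega⟩

/-- The second of the two adjacent positions labelled by `j`. -/
def rightPos {N : ℕ} (j : Fin (N - 1)) : Fin N := ⟨j + 1, by omega⟩

/-- The simple transposition `s_j`, exchanging two adjacent positions. -/
def simpleSwap {N : ℕ} (j : Fin (N - 1)) : Equiv.Perm (Fin N) :=
  Equiv.swap (leftPos j) (rightPos j)

/-- Every permutation is a product of simple transpositions. -/
theorem exists_word {N : ℕ} (w : Equiv.Perm (Fin N)) :
    ∃ l : List (Fin (N - 1)), (l.map simpleSwap).prod = w := by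
  cases N with
  | zero => exact ⟨[], Subsingleton.elim _ _⟩
  | succ n =>
    have hw : w ∈ Submonoid.closure (Set.range fun i : Fin n => Equiv.swap i.castSucc i.succ) := by
      rw [Equiv.Perm.mclosure_swap_castSucc_succ]; trivial
    induction hw using Submonoid.closure_induction with
    | mem x hx =>
      obtain ⟨i, rfl⟩ := hx
      exact ⟨[i], by simp [simpleSwap, leftPos, rightPos]; rfl⟩
    | one => exact ⟨[], rfl⟩
    | mul x y _ _ hx hy =>
      obtain ⟨l, rfl⟩ := hx
      obtain ⟨m, rfl⟩ := hy
      exact ⟨l ++ m, by simp⟩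

/-- A decomposition `w = s_{i_1} ... s_{i_l}` into simple transpositions. -/
def word {N : ℕ} (w : Equiv.Perm (Fin N)) : List (Fin (N - 1)) := Classical.choose (exists_word w)

/-- The integral operator
`(I_{jk} f)(x) = ∫_0^{x_j - x_k} f (x - y (e_j - e_k)) dy`. -/
def integralOp {N : ℕ} (j k : Fin N) (f : (Fin N → ℝ) → ℂ) : (Fin N → ℝ) → ℂ :=
  fun x => ∫ y in (0 : ℝ)..(x j - x k), f (x - y • (Pi.single j 1 - Pi.single k 1))

/-- The deformed simple transposition `s_{j,γ} = s_j + γ I_{j,j+1}`. -/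
def deformedSwap {N : ℕ} (γ : ℝ) (j : Fin (N - 1)) (f : (Fin N → ℝ) → ℂ) : (Fin N → ℝ) → ℂ :=
  fun x => permFun (simpleSwap j) f x + (γ : ℂ) * integralOp (leftPos j) (rightPos j) f x

/-- The deformed permutation `w_γ = s_{i_1,γ} ∘ ... ∘ s_{i_l,γ}`, where `w = s_{i_1} ... s_{i_l}`.
On smooth functions it does not depend on the decomposition. -/
def deformedPerm {N : ℕ} (γ : ℝ) (w : Equiv.Perm (Fin N)) (f : (Fin N → ℝ) → ℂ) :
    (Fin N → ℝ) → ℂ :=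
  (word w).foldr (deformedSwap γ) f

/-- The propagation operator `P_γ = ∑_w χ_{w⁻¹ ℝ^N_+} w⁻¹ w_γ`, meaningful at regular vectors;
note that `x ∈ w⁻¹ ℝ^N_+` if and only if `w x ∈ ℝ^N_+`. -/
def propagation {N : ℕ} (γ : ℝ) (f : (Fin N → ℝ) → ℂ) : (Fin N → ℝ) → ℂ :=
  fun x => ∑ w : Equiv.Perm (Fin N),
    {x' | permVec w x' ∈ fundamentalAlcove N}.indicator (permFun w⁻¹ (deformedPerm γ w f)) x

/-- The plane wave `x ↦ exp (i ∑_j λ_j x_j)`. -/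
def planeWave {N : ℕ} (lam : Fin N → ℂ) : (Fin N → ℝ) → ℂ :=
  fun x => Complex.exp (Complex.I * ∑ j, lam j * (x j : ℂ))

/-- The pre-wavefunction `ψ_λ`: the continuous extension to all of `ℝ^N` of `P_γ e^{iλ}`, which is
defined on the regular vectors. -/
def preWave {N : ℕ} (γ : ℝ) (lam : Fin N → ℂ) : (Fin N → ℝ) → ℂ :=
  extendFrom (regularVectors N) (propagation γ (planeWave lam))

/-- The integral `∫_{lo_1}^{hi_1} dy_1 ... ∫_{lo_n}^{hi_n} dy_n F (y_1, ..., y_n)`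
(oriented one-dimensional integrals). -/
def iterIntegral : (n : ℕ) → (Fin n → ℝ) → (Fin n → ℝ) → ((Fin n → ℝ) → ℂ) → ℂ
  | 0, _, _, F => F Fin.elim0
  | n + 1, lo, hi, F =>
      ∫ y in (lo 0)..(hi 0), iterIntegral n (Fin.tail lo) (Fin.tail hi) fun ys => F (Fin.cons y ys)

/-- Replacement of the coordinates: `x_{i_m}` becomes `y_m`, the others are kept. -/
def replaceCoords {N n : ℕ} (i : Fin n ↪ Fin N) (y : Fin n → ℝ) (x : Fin N → ℝ) : Fin N → ℝ :=
  Function.extend i y x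

/-- `∏_m (∫_{lo_m}^{hi_m} dy_m exp (i μ (x_{i_m} - y_m))) f (x with x_{i_m} replaced by y_m)`. -/
def kernelIntegral {N n : ℕ} (μ : ℂ) (i : Fin n ↪ Fin N) (lo hi : Fin n → ℝ)
    (f : (Fin N → ℝ) → ℂ) (x : Fin N → ℝ) : ℂ :=
  iterIntegral n lo hi fun y =>
    (∏ m, Complex.exp (Complex.I * μ * ((x (i m) : ℂ) - (y m : ℂ)))) * f (replaceCoords i y x)

/-- The multidimensional step function `θ (z_1 > ... > z_n)`. -/
def stepFun {n : ℕ} (z : Fin n → ℝ) : ℂ :=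
  open Classical in if StrictAnti z then 1 else 0

/-- The sequence `(top, z_1, ..., z_n)`. -/
def withTop {n : ℕ} (top : ℝ) (z : Fin n → ℝ) : Fin (n + 1) → ℝ := Fin.cons top z

/-- The sequence `(z_1, ..., z_n, bot)`. -/
def withBot {n : ℕ} (z : Fin n → ℝ) (bot : ℝ) : Fin (n + 1) → ℝ := Fin.snoc z bot

/-- The elementary operator `\hat e^+_{μ;i}`; with `z_m = x_{i_m + 1}` and `z_{n+1} = x_1`, the
`m`-th integral runs from `z_{m+1}` to `z_m`. -/
def eHatPlus {N n : ℕ} (μ : ℂ) (i : Fin n ↪ Fin N) (f : (Fin N → ℝ) → ℂ) :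
    (Fin (N + 1) → ℝ) → ℂ := fun x =>
  let x' : Fin N → ℝ := Fin.tail x
  let z : Fin n → ℝ := fun m => x' (i m)
  Complex.exp (Complex.I * μ * (x 0 : ℂ)) * stepFun (withBot z (x 0)) *
    kernelIntegral μ i (fun m => withBot z (x 0) m.succ) z f x'

/-- The elementary operator `\hat e^-_{μ;i}`; with `z_m = x_{i_m}` and `z_0 = x_{N+1}`, the
`m`-th integral runs from `z_m` to `z_{m-1}`. -/
def eHatMinus {N n : ℕ} (μ : ℂ) (i : Fin n ↪ Fin N) (f : (Fin N → ℝ) → ℂ) :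
    (Fin (N + 1) → ℝ) → ℂ := fun x =>
  let x' : Fin N → ℝ := Fin.init x
  let z : Fin n → ℝ := fun m => x' (i m)
  Complex.exp (Complex.I * μ * (x (Fin.last N) : ℂ)) * stepFun (withTop (x (Fin.last N)) z) *
    kernelIntegral μ i z (fun m => withTop (x (Fin.last N)) z m.castSucc) f x'

/-- The elementary operator `\bar e^+_{μ;i}` at points of `[-L/2, L/2]^N`; with `z_m = x_{i_m}`
and `z_{n+1} = -L/2`, the `m`-th integral runs from `z_{m+1}` to `z_m`. -/
def eBarPlus {N n : ℕ} (L : ℝ) (μ : ℂ) (i : Fin n ↪ Fin N) (f : (Fin N → ℝ) → ℂ) :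
    (Fin N → ℝ) → ℂ := fun x =>
  let z : Fin n → ℝ := fun m => x (i m)
  Complex.exp (-Complex.I * μ * (L : ℂ) / 2) * stepFun z *
    kernelIntegral μ i (fun m => withBot z (-L / 2) m.succ) z f x

/-- The elementary operator `\bar e^-_{μ;i}` at points of `[-L/2, L/2]^N`; with `z_m = x_{i_m}`
and `z_0 = L/2`, the `m`-th integral runs from `z_m` to `z_{m-1}`. -/
def eBarMinus {N n : ℕ} (L : ℝ) (μ : ℂ) (i : Fin n ↪ Fin N) (f : (Fin N → ℝ) → ℂ) :
    (Fin N → ℝ) → ℂ := fun x =>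
  let z : Fin n → ℝ := fun m => x (i m)
  Complex.exp (Complex.I * μ * (L : ℂ) / 2) * stepFun z *
    kernelIntegral μ i z (fun m => withTop (L / 2) z m.castSucc) f x

/-- `b^+_μ = ∑_{n ≥ 0} γ^n ∑_i \hat e^+_{μ;i}`, the inner sum over `n`-tuples of distinct indices
(there are none when `n > N`). -/
def bPlus {N : ℕ} (γ : ℝ) (μ : ℂ) (f : (Fin N → ℝ) → ℂ) : (Fin (N + 1) → ℝ) → ℂ := fun x =>
  ∑ n ∈ Finset.range (N + 1), (γ : ℂ) ^ n * ∑ i : Fin n ↪ Fin N, eHatPlus μ i f x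

/-- `b^-_μ = ∑_{n ≥ 0} γ^n ∑_i \hat e^-_{μ;i}`. -/
def bMinus {N : ℕ} (γ : ℝ) (μ : ℂ) (f : (Fin N → ℝ) → ℂ) : (Fin (N + 1) → ℝ) → ℂ := fun x =>
  ∑ n ∈ Finset.range (N + 1), (γ : ℂ) ^ n * ∑ i : Fin n ↪ Fin N, eHatMinus μ i f x

/-- `a_μ = ∑_{n ≥ 0} γ^n ∑_i \bar e^+_{μ;i}`, at points of `[-L/2, L/2]^N`. -/
def aOp {N : ℕ} (γ L : ℝ) (μ : ℂ) (f : (Fin N → ℝ) → ℂ) : (Fin N → ℝ) → ℂ := fun x =>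
  ∑ n ∈ Finset.range (N + 1), (γ : ℂ) ^ n * ∑ i : Fin n ↪ Fin N, eBarPlus L μ i f x

/-- `d_μ = ∑_{n ≥ 0} γ^n ∑_i \bar e^-_{μ;i}`, at points of `[-L/2, L/2]^N`. -/
def dOp {N : ℕ} (γ L : ℝ) (μ : ℂ) (f : (Fin N → ℝ) → ℂ) : (Fin N → ℝ) → ℂ := fun x =>
  ∑ n ∈ Finset.range (N + 1), (γ : ℂ) ^ n * ∑ i : Fin n ↪ Fin N, eBarMinus L μ i f x

/-- `τ^+_μ(λ) = ∏_j (λ_j - μ - iγ) / (λ_j - μ)`. -/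
def tauPlus {N : ℕ} (γ : ℝ) (μ : ℂ) (lam : Fin N → ℂ) : ℂ :=
  ∏ j, (lam j - μ - Complex.I * (γ : ℂ)) / (lam j - μ)

/-- `τ^-_μ(λ) = ∏_j (λ_j - μ + iγ) / (λ_j - μ)`. -/
def tauMinus {N : ℕ} (γ : ℝ) (μ : ℂ) (lam : Fin N → ℂ) : ℂ :=
  ∏ j, (lam j - μ + Complex.I * (γ : ℂ)) / (lam j - μ)

/-- The parameter vector `(λ, μ)`. -/
def appendLast {N : ℕ} (lam : Fin N → ℂ) (μ : ℂ) : Fin (N + 1) → ℂ := Fin.snoc lam μ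

/-- The parameter vector `(μ, λ)`. -/
def appendFirst {N : ℕ} (μ : ℂ) (lam : Fin N → ℂ) : Fin (N + 1) → ℂ := Fin.cons μ lam

end QNLS

end

/-! Let `recWave` be the function obtained from the constant 1 by applying b^-_{λ_1}, ..., b^-_{λ_N}
in turn. Its recursion in the last parameter is the first assertion, so the real task is to identify
it with the pre-wavefunction. On the closed chamber x_1 ≥ ... ≥ x_N every term with a nonempty index
tuple vanishes, and `recWave` is the plane wave. Its values elsewhere are governed by the exchange
relations (`exchange`): with c = -iγ/(λ_j - λ_{j+1}), the value at s_j x is (1 - c) times the value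
at x with λ_j, λ_{j+1} exchanged, plus c times the value at x. A direct integration shows that
s_{j,γ} acts on plane waves by the same formula (`deformedSwap_planeWave`). Hence w_γ e^{iλ} and x ↦
recWave(x∘w) are the same combination of plane waves and of `recWave`s respectively, and they agree
on the chamber. This gives equality on regular points, and density and continuity give it
everywhere.

The exchange relations are proved by induction on N. A transposition not involving the last variable
passes through b^- by linearity and equivariance. For the last one, the analytic input is
`bMinus_bMinus_of_le`: if u lies below all other coordinates, b^-_μ b^-_κ f at (x, u, t) is an
explicit combination of e^{iκu} b^-_μ f(x, t) and e^{iμu} b^-_κ f(x, t). It settles the case in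
which one of the two exchanged variables is the lowest. Otherwise a lower third variable exists
after sorting, and going the other way round the braid hexagon reduces to known cases; consistency
is the partial fraction identity `exchangeCoeff_mul`.

The reflection x ↦ (-x_N, ..., -x_1) turns b^+_μ into b^-_{-μ} and a_μ into d_{-μ}. The `recWave`s
are compatible with it, again by the exchange relations.

For the limits, d_μ f(x) = b^-_μ f(x, L/2) once L/2 exceeds every coordinate. On the chamber,
`bMinus_bMinus_of_le` removes the lowest variable at the price of one factor of τ^-, up to a bounded
function times a decaying exponential; the exchange relations carry the limit to the other chambers.
-/

noncomputable section

namespace QNLS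

/-! ### Iterated integrals -/

theorem continuous_parametric_intervalIntegral {X : Type*} [TopologicalSpace X] {f : X → ℝ → ℂ}
    {a b : X → ℝ} (hf : Continuous (Function.uncurry f)) (ha : Continuous a) (hb : Continuous b) :
    Continuous fun x => ∫ y in (a x)..(b x), f x y := by
  have hi : ∀ x s t, IntervalIntegrable (f x) MeasureTheory.volume s t := fun x s t =>
    (hf.comp (Continuous.prodMk_right x)).intervalIntegrable s t
  have h : (fun x => ∫ y in (a x)..(b x), f x y)
      = fun x => (∫ y in (0 : ℝ)..(b x), f x y) - ∫ y in (0 : ℝ)..(a x), f x y := by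
    funext x
    rw [intervalIntegral.integral_interval_sub_left (hi x _ _) (hi x _ _)]
  rw [h]
  exact (intervalIntegral.continuous_parametric_intervalIntegral_of_continuous hf hb).sub
    (intervalIntegral.continuous_parametric_intervalIntegral_of_continuous hf ha)

theorem continuous_finCons {X : Type*} [TopologicalSpace X] {n : ℕ} {f : X → ℝ}
    {g : X → Fin n → ℝ} (hf : Continuous f) (hg : Continuous g) :
    Continuous fun x => (Fin.cons (f x) (g x) : Fin (n + 1) → ℝ) := by
  refine continuous_pi fun i => ?_
  refine Fin.cases ?_ (fun i => ?_) i
  · simpa using hf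
  · simpa [Function.comp_def] using (continuous_apply i).comp hg

theorem continuous_finSnoc {X : Type*} [TopologicalSpace X] {n : ℕ} {f : X → ℝ}
    {g : X → Fin n → ℝ} (hg : Continuous g) (hf : Continuous f) :
    Continuous fun x => (Fin.snoc (g x) (f x) : Fin (n + 1) → ℝ) := by
  refine continuous_pi fun i => ?_
  refine Fin.lastCases ?_ (fun i => ?_) i
  · simpa using hf
  · simpa [Function.comp_def] using (continuous_apply i).comp hg

theorem continuous_iterIntegral {n : ℕ} : ∀ {X : Type} [TopologicalSpace X]
    {lo hi : X → Fin n → ℝ} {F : X → (Fin n → ℝ) → ℂ}, Continuous lo → Continuous hi →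
    Continuous (Function.uncurry F) → Continuous fun x => iterIntegral n (lo x) (hi x) (F x) := by
  induction n with
  | zero =>
    intro X _ lo hi F _ _ hF
    exact hF.comp (continuous_id.prodMk continuous_const)
  | succ n ih =>
    intro X _ lo hi F hlo hhi hF
    refine continuous_parametric_intervalIntegral ?_ ((continuous_apply 0).comp hlo)
      ((continuous_apply 0).comp hhi)
    -- The outer integration variable joins the parameters, which is why the parameter space is
    -- quantified inside the induction.
    refine ih (X := X × ℝ) (lo := fun p => Fin.tail (lo p.1)) (hi := fun p => Fin.tail (hi p.1))
      (F := fun p ys => F p.1 (Fin.cons p.2 ys)) ?_ ?_ ?_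
    · exact continuous_pi fun i => ((continuous_apply i.succ).comp hlo).comp continuous_fst
    · exact continuous_pi fun i => ((continuous_apply i.succ).comp hhi).comp continuous_fst
    · exact hF.comp ((continuous_fst.comp continuous_fst).prodMk
        (continuous_finCons (continuous_snd.comp continuous_fst) continuous_snd))

theorem continuous_iterIntegral_cons {n : ℕ} {lo hi : Fin n → ℝ} {F : (Fin (n + 1) → ℝ) → ℂ}
    (hF : Continuous F) :
    Continuous fun y : ℝ => iterIntegral n lo hi fun ys => F (Fin.cons y ys) :=
  continuous_iterIntegral (X := ℝ) (F := fun y ys => F (Fin.cons y ys)) continuous_const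
    continuous_const (hF.comp (continuous_finCons continuous_fst continuous_snd))

theorem iterIntegral_congr {n : ℕ} {lo hi : Fin n → ℝ} {F G : (Fin n → ℝ) → ℂ}
    (h : ∀ y, F y = G y) : iterIntegral n lo hi F = iterIntegral n lo hi G := by
  rw [funext h]

theorem iterIntegral_const_mul {n : ℕ} (c : ℂ) : ∀ (lo hi : Fin n → ℝ) (F : (Fin n → ℝ) → ℂ),
    iterIntegral n lo hi (fun y => c * F y) = c * iterIntegral n lo hi F := by
  induction n with
  | zero => intros; rfl
  | succ n ih =>
    intro lo hi F
    simp only [iterIntegral, ih, intervalIntegral.integral_const_mul]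

theorem iterIntegral_add {n : ℕ} : ∀ (lo hi : Fin n → ℝ) (F G : (Fin n → ℝ) → ℂ),
    Continuous F → Continuous G →
    iterIntegral n lo hi (fun y => F y + G y) = iterIntegral n lo hi F + iterIntegral n lo hi G := by
  induction n with
  | zero => intros; rfl
  | succ n ih =>
    intro lo hi F G hF hG
    have hc : ∀ y : ℝ, Continuous fun ys : Fin n → ℝ => (Fin.cons y ys : Fin (n + 1) → ℝ) :=
      fun y => continuous_finCons continuous_const continuous_id
    simp only [iterIntegral]
    rw [← intervalIntegral.integral_add
      ((continuous_iterIntegral_cons hF).intervalIntegrable _ _)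
      ((continuous_iterIntegral_cons hG).intervalIntegrable _ _)]
    exact intervalIntegral.integral_congr fun y _ =>
      ih _ _ _ _ (hF.comp (hc y)) (hG.comp (hc y))

theorem iterIntegral_eq_zero {n : ℕ} : ∀ {lo hi : Fin n → ℝ} (F : (Fin n → ℝ) → ℂ) (m : Fin n),
    lo m = hi m → iterIntegral n lo hi F = 0 := by
  induction n with
  | zero => intro _ _ _ m; exact m.elim0
  | succ n ih =>
    intro lo hi F m h
    refine Fin.cases (fun h => ?_) (fun m h => ?_) m h
    · simp [iterIntegral, h]
    · have : ∀ y : ℝ, iterIntegral n (Fin.tail lo) (Fin.tail hi) (fun ys => F (Fin.cons y ys)) = 0 :=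
        fun y => ih _ m h
      simp [iterIntegral, this]

theorem iterIntegral_comp_neg {n : ℕ} : ∀ (lo hi : Fin n → ℝ) (F : (Fin n → ℝ) → ℂ),
    iterIntegral n lo hi F = iterIntegral n (-hi) (-lo) fun y => F (-y) := by
  induction n with
  | zero => intro _ _ F; simp only [iterIntegral]; congr 1; exact Subsingleton.elim _ _
  | succ n ih =>
    intro lo hi F
    simp only [iterIntegral, Pi.neg_apply]
    refine Eq.trans ?_ (intervalIntegral.integral_comp_neg (a := lo 0) (b := hi 0) fun y =>
      iterIntegral n (Fin.tail (-hi)) (Fin.tail (-lo)) fun ys => F (-Fin.cons y ys))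
    refine intervalIntegral.integral_congr fun y _ => ?_
    refine (ih (Fin.tail lo) _ _).trans ?_
    have h1 : Fin.tail (-hi) = -Fin.tail hi := rfl
    have h2 : Fin.tail (-lo) = -Fin.tail lo := rfl
    rw [h1, h2]
    refine iterIntegral_congr fun ys => ?_
    congr 1
    funext i
    refine Fin.cases ?_ (fun i => ?_) i <;> simp

theorem intervalIntegral_swap {f : ℝ → ℝ → ℂ} (hf : Continuous (Function.uncurry f))
    (a b c d : ℝ) :
    ∫ x in a..b, ∫ y in c..d, f x y = ∫ y in c..d, ∫ x in a..b, f x y := by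
  simp only [intervalIntegral.intervalIntegral_eq_integral_uIoc, MeasureTheory.integral_smul]
  rw [smul_comm, MeasureTheory.integral_integral_swap]
  rw [MeasureTheory.Measure.prod_restrict]
  exact (hf.continuousOn.integrableOn_compact (isCompact_uIcc.prod isCompact_uIcc)).mono_set
    (Set.prod_mono Set.uIoc_subset_uIcc Set.uIoc_subset_uIcc)

/-- Fubini: the last variable may be moved outermost. It serves to reverse the order of the
variables under reflection. -/
theorem iterIntegral_succ_snoc {n : ℕ} : ∀ (lo hi : Fin (n + 1) → ℝ) (F : (Fin (n + 1) → ℝ) → ℂ),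
    Continuous F →
    iterIntegral (n + 1) lo hi F = ∫ y in (lo (Fin.last n))..(hi (Fin.last n)),
      iterIntegral n (Fin.init lo) (Fin.init hi) fun ys => F (Fin.snoc ys y) := by
  induction n with
  | zero =>
    intro lo hi F _
    simp only [iterIntegral]
    refine intervalIntegral.integral_congr fun y _ => ?_
    congr 1
    funext i
    fin_cases i
    rfl
  | succ n ih =>
    intro lo hi F hF
    have hc : ∀ y : ℝ, Continuous fun ys : Fin (n + 1) → ℝ => (Fin.cons y ys : Fin (n + 2) → ℝ) :=
      fun y => continuous_finCons continuous_const continuous_id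
    rw [iterIntegral]
    calc _ = ∫ y in (lo 0)..(hi 0), ∫ v in (lo (Fin.last (n + 1)))..(hi (Fin.last (n + 1))),
          iterIntegral n (Fin.init (Fin.tail lo)) (Fin.init (Fin.tail hi))
            fun ys => F (Fin.cons y (Fin.snoc ys v)) :=
          intervalIntegral.integral_congr fun y _ => ih _ _ _ (hF.comp (hc y))
      _ = _ := by
        rw [intervalIntegral_swap]
        · refine intervalIntegral.integral_congr fun v _ => ?_
          simp only [iterIntegral, Fin.cons_snoc_eq_snoc_cons]
          rfl
        · exact continuous_iterIntegral (X := ℝ × ℝ)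
            (F := fun p ys => F (Fin.cons p.1 (Fin.snoc ys p.2))) continuous_const continuous_const
            (hF.comp (continuous_finCons (continuous_fst.comp continuous_fst)
              (continuous_finSnoc continuous_snd (continuous_snd.comp continuous_fst))))

theorem iterIntegral_comp_rev {n : ℕ} : ∀ (lo hi : Fin n → ℝ) (F : (Fin n → ℝ) → ℂ),
    Continuous F →
    iterIntegral n lo hi F = iterIntegral n (lo ∘ Fin.rev) (hi ∘ Fin.rev) fun y => F (y ∘ Fin.rev) := by
  induction n with
  | zero => intro _ _ F _; simp only [iterIntegral]; congr 1
  | succ n ih =>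
    intro lo hi F hF
    rw [iterIntegral_succ_snoc _ _ _ hF]
    simp only [iterIntegral, Function.comp_apply, Fin.rev_zero]
    refine intervalIntegral.integral_congr fun y _ => ?_
    refine (ih _ _ _ (hF.comp (continuous_finSnoc (f := fun _ => y) continuous_id
      continuous_const))).trans ?_
    have h : ∀ g : Fin (n + 1) → ℝ, Fin.init g ∘ Fin.rev = Fin.tail (g ∘ Fin.rev) := fun g => by
      funext i
      simp [Fin.init, Fin.tail, Fin.rev_succ]
    rw [h, h]
    refine iterIntegral_congr fun ys => ?_
    refine congrArg F (funext fun i => ?_)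
    simp [Fin.cons_rev]

/-! ### The operator `b^-` -/

/-- If θ is 1, every maximum is the original upper bound; if θ is 0, two consecutive entries are in
the wrong order or equal and the corresponding interval collapses. The discontinuous θ is thus
absorbed into continuous bounds, which makes b^- preserve continuity. -/
theorem stepFun_mul_iterIntegral {n : ℕ} (t : ℝ) (z : Fin n → ℝ) (F : (Fin n → ℝ) → ℂ) :
    stepFun (withTop t z) * iterIntegral n z (fun m => withTop t z m.castSucc) F
      = iterIntegral n z (fun m => max (z m) (withTop t z m.castSucc)) F := by
  by_cases h : StrictAnti (withTop t z)
  · have h' : ∀ m, max (z m) (withTop t z m.castSucc) = withTop t z m.castSucc := fun m => by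
      have := Fin.strictAnti_iff_succ_lt.1 h m
      simp only [withTop, Fin.cons_succ] at this ⊢
      exact max_eq_right this.le
    simp [stepFun, h, h']
  · have h0 := h
    rw [Fin.strictAnti_iff_succ_lt] at h0
    push Not at h0
    obtain ⟨m, hm⟩ := h0
    have hm' : z m = max (z m) (withTop t z m.castSucc) := (max_eq_left hm).symm
    rw [iterIntegral_eq_zero (hi := fun m => max (z m) (withTop t z m.castSucc)) _ m hm']
    simp [stepFun, h]

theorem eHatMinus_snoc {N n : ℕ} (μ : ℂ) (i : Fin n ↪ Fin N) (f : (Fin N → ℝ) → ℂ)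
    (x : Fin N → ℝ) (t : ℝ) :
    eHatMinus μ i f (Fin.snoc x t) = Complex.exp (Complex.I * μ * (t : ℂ)) *
      iterIntegral n (fun m => x (i m))
        (fun m => max (x (i m)) (withTop t (fun m => x (i m)) m.castSucc))
        fun y => (∏ m, Complex.exp (Complex.I * μ * ((x (i m) : ℂ) - (y m : ℂ)))) *
          f (replaceCoords i y x) := by
  simp only [eHatMinus, kernelIntegral, Fin.snoc_last, Fin.init_snoc]
  rw [mul_assoc, stepFun_mul_iterIntegral]

theorem continuous_replaceCoords {X : Type*} [TopologicalSpace X] {N n : ℕ} (i : Fin n ↪ Fin N)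
    {y : X → Fin n → ℝ} {x : X → Fin N → ℝ} (hy : Continuous y) (hx : Continuous x) :
    Continuous fun p => replaceCoords i (y p) (x p) := by
  refine continuous_pi fun k => ?_
  by_cases h : ∃ m, i m = k
  · obtain ⟨m, rfl⟩ := h
    simp only [replaceCoords, i.injective.extend_apply]
    exact (continuous_apply m).comp hy
  · simp only [replaceCoords, Function.extend_apply' _ _ _ h]
    exact (continuous_apply k).comp hx

theorem continuous_eHatMinus {N n : ℕ} (μ : ℂ) (i : Fin n ↪ Fin N) {f : (Fin N → ℝ) → ℂ}
    (hf : Continuous f) : Continuous (eHatMinus μ i f) := by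
  have h : eHatMinus μ i f = fun x => eHatMinus μ i f (Fin.snoc (Fin.init x) (x (Fin.last N))) := by
    funext x; rw [Fin.snoc_init_self]
  rw [h]
  simp only [eHatMinus_snoc]
  have hx : Continuous fun x : Fin (N + 1) → ℝ => (Fin.init x : Fin N → ℝ) :=
    continuous_pi fun k => continuous_apply (Fin.castSucc k)
  refine Continuous.mul (by fun_prop) (continuous_iterIntegral ?_ ?_ ?_)
  · exact continuous_pi fun m => (continuous_apply (i m)).comp hx
  · refine continuous_pi fun m => ((continuous_apply (i m)).comp hx).max ?_
    exact (continuous_apply m.castSucc).comp (continuous_finCons (continuous_apply _)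
      (continuous_pi fun m => (continuous_apply (i m)).comp hx))
  · refine Continuous.mul ?_ (hf.comp (continuous_replaceCoords i continuous_snd
      (hx.comp continuous_fst)))
    refine continuous_finsetProd _ fun m _ => Complex.continuous_exp.comp
      (continuous_const.mul (Continuous.sub ?_ ?_))
    · exact Complex.continuous_ofReal.comp (((continuous_apply (i m)).comp hx).comp continuous_fst)
    · exact Complex.continuous_ofReal.comp ((continuous_apply m).comp continuous_snd)

theorem continuous_bMinus {N : ℕ} (γ : ℝ) (μ : ℂ) {f : (Fin N → ℝ) → ℂ} (hf : Continuous f) :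
    Continuous (bMinus γ μ f) :=
  continuous_finsetSum _ fun _ _ => continuous_const.mul
    (continuous_finsetSum _ fun i _ => continuous_eHatMinus μ i hf)

theorem replaceCoords_cons {N n : ℕ} (e : Fin (n + 1) ↪ Fin N) (e' : Fin n ↪ Fin N)
    (he : ∀ m, e' m = e m.succ) (y : ℝ) (ys : Fin n → ℝ) (x : Fin N → ℝ) :
    replaceCoords e (Fin.cons y ys) x = replaceCoords e' ys (Function.update x (e 0) y) := by
  funext k
  by_cases h : ∃ m, e m = k
  · obtain ⟨m, rfl⟩ := h
    simp only [replaceCoords, e.injective.extend_apply]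
    refine Fin.cases ?_ (fun m => ?_) m
    · rw [Function.extend_apply']
      · simp
      · rintro ⟨m, hm⟩
        rw [he] at hm
        exact absurd (e.injective hm) (Fin.succ_ne_zero m)
    · rw [← he, e'.injective.extend_apply]
      simp
  · have h' : ¬ ∃ m, e' m = k := fun ⟨m, hm⟩ => h ⟨m.succ, by rw [← he, hm]⟩
    rw [replaceCoords, replaceCoords, Function.extend_apply' _ _ _ h,
      Function.extend_apply' _ _ _ h', Function.update_of_ne]
    rintro rfl
    exact h ⟨0, rfl⟩

/-- Once the outermost variable y is fixed, the remaining integrals form the elementary operator of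
the shortened tuple, with x_{e 0} as the new top and y in place of x_{e 0}. The exponentials regroup
because t + (x_{e 0} - y) = (t - y) + x_{e 0}. -/
theorem eHatMinus_succ {N n : ℕ} (μ : ℂ) (e : Fin (n + 1) ↪ Fin N) (e' : Fin n ↪ Fin N)
    (he : ∀ m, e' m = e m.succ) (f : (Fin N → ℝ) → ℂ) (x : Fin N → ℝ) (t : ℝ) :
    eHatMinus μ e f (Fin.snoc x t) = ∫ y in (x (e 0))..(max (x (e 0)) t),
      Complex.exp (Complex.I * μ * ((t : ℂ) - (y : ℂ))) *
        eHatMinus μ e' f (Fin.snoc (Function.update x (e 0) y) (x (e 0))) := by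
  have hne : ∀ m, e' m ≠ e 0 := fun m h => by
    rw [he] at h
    exact absurd (e.injective h) (Fin.succ_ne_zero m)
  rw [eHatMinus_snoc, iterIntegral, ← intervalIntegral.integral_const_mul]
  refine intervalIntegral.integral_congr fun y _ => ?_
  simp only [eHatMinus_snoc, Function.update_of_ne (hne _)]
  rw [← mul_assoc, ← Complex.exp_add, ← iterIntegral_const_mul, ← iterIntegral_const_mul]
  have h1 : Fin.tail (fun m => x (e m)) = fun m => x (e' m) := by
    funext m; simp [Fin.tail, he]
  have h2 : Fin.tail (fun m => max (x (e m)) (withTop t (fun m => x (e m)) m.castSucc))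
      = fun m => max (x (e' m)) (withTop (x (e 0)) (fun m => x (e' m)) m.castSucc) := by
    funext m
    simp only [Fin.tail, he]
    congr 1
    simp only [withTop, ← Fin.succ_castSucc, Fin.cons_succ]
    generalize m.castSucc = j
    refine Fin.cases ?_ (fun m => ?_) j <;> simp
  rw [h1, h2]
  refine iterIntegral_congr fun ys => ?_
  rw [replaceCoords_cons e e' he, Fin.prod_univ_succ]
  simp only [Fin.cons_zero, Fin.cons_succ, he]
  rw [← mul_assoc, ← mul_assoc, ← mul_assoc, ← Complex.exp_add]
  ring_nf

theorem eHatMinus_eq_zero {N n : ℕ} (μ : ℂ) (e : Fin n ↪ Fin N) (f : (Fin N → ℝ) → ℂ)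
    (x : Fin N → ℝ) (t : ℝ) (m : Fin n) (h : t ≤ x (e m)) :
    eHatMinus μ e f (Fin.snoc x t) = 0 := by
  have : ¬ StrictAnti (withTop t fun m => x (e m)) := fun hs => by
    have := hs (Fin.succ_pos m)
    simp only [withTop, Fin.cons_succ, Fin.cons_zero] at this
    linarith
  simp [eHatMinus, stepFun, this]

theorem eHatMinus_zero {N : ℕ} (μ : ℂ) (e : Fin 0 ↪ Fin N) (f : (Fin N → ℝ) → ℂ)
    (x : Fin N → ℝ) (t : ℝ) :
    eHatMinus μ e f (Fin.snoc x t) = Complex.exp (Complex.I * μ * (t : ℂ)) * f x := by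
  have h : replaceCoords e Fin.elim0 x = x := by
    funext k
    exact Function.extend_apply' _ _ _ fun ⟨m, _⟩ => m.elim0
  simp [eHatMinus_snoc, iterIntegral, h]

/-- Every nonempty tuple violates t > z_1, so only n = 0 survives. This is the initial condition for
all later inductions. -/
theorem bMinus_of_le {N : ℕ} (γ : ℝ) (μ : ℂ) (f : (Fin N → ℝ) → ℂ) (x : Fin N → ℝ) (t : ℝ)
    (h : ∀ k, t ≤ x k) :
    bMinus γ μ f (Fin.snoc x t) = Complex.exp (Complex.I * μ * (t : ℂ)) * f x := by
  rw [bMinus, Finset.sum_range_succ', Finset.sum_eq_zero]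
  · simp [eHatMinus_zero]
  · intro n _
    rw [Finset.sum_eq_zero, mul_zero]
    intro i _
    exact eHatMinus_eq_zero μ i f x t 0 (h _)

/-- The recursion for `b^-` obtained by splitting off the outermost integral. -/
theorem bMinus_snoc {N : ℕ} (γ : ℝ) (μ : ℂ) {f : (Fin N → ℝ) → ℂ} (hf : Continuous f)
    (x : Fin N → ℝ) (t : ℝ) :
    bMinus γ μ f (Fin.snoc x t) = Complex.exp (Complex.I * μ * (t : ℂ)) * f x +
      γ * ∑ k, ∫ y in (x k)..(max (x k) t), Complex.exp (Complex.I * μ * ((t : ℂ) - (y : ℂ))) *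
        bMinus γ μ f (Fin.snoc (Function.update x k y) (x k)) := by
  classical
  have hint : ∀ (n : ℕ) (e : Fin n ↪ Fin N) (k : Fin N), Continuous fun y : ℝ =>
      Complex.exp (Complex.I * μ * ((t : ℂ) - (y : ℂ))) *
        eHatMinus μ e f (Fin.snoc (Function.update x k y) (x k)) := fun n e k =>
    Continuous.mul (by fun_prop) ((continuous_eHatMinus μ e hf).comp
      (continuous_finSnoc (continuous_const.update k continuous_id) continuous_const))
  -- A tuple that uses k again sees the coordinate y above the top x k, so its θ vanishes. The sum
  -- over all k is therefore the same as the sum over k outside the tuple.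
  have hzero : ∀ (n : ℕ) (e : Fin n ↪ Fin N) (k : Fin N), k ∈ Set.range e →
      (∫ y in (x k)..(max (x k) t), Complex.exp (Complex.I * μ * ((t : ℂ) - (y : ℂ))) *
        eHatMinus μ e f (Fin.snoc (Function.update x k y) (x k))) = 0 := by
    rintro n e k ⟨m, rfl⟩
    refine intervalIntegral.integral_zero_ae (Eventually.of_forall fun y hy => ?_)
    rw [Set.uIoc_of_le (le_max_left _ _)] at hy
    rw [eHatMinus_eq_zero μ e f _ _ m, mul_zero]
    simpa using hy.1.le
  have hsum : ∀ k, (∫ y in (x k)..(max (x k) t),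
      Complex.exp (Complex.I * μ * ((t : ℂ) - (y : ℂ))) *
        bMinus γ μ f (Fin.snoc (Function.update x k y) (x k)))
      = ∑ n ∈ Finset.range N, (γ : ℂ) ^ n * ∑ e : Fin n ↪ Fin N, ∫ y in (x k)..(max (x k) t),
        Complex.exp (Complex.I * μ * ((t : ℂ) - (y : ℂ))) *
          eHatMinus μ e f (Fin.snoc (Function.update x k y) (x k)) := by
    intro k
    have hexp : ∀ y : ℝ, Complex.exp (Complex.I * μ * ((t : ℂ) - (y : ℂ))) *
        bMinus γ μ f (Fin.snoc (Function.update x k y) (x k)) = ∑ n ∈ Finset.range (N + 1),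
          (γ : ℂ) ^ n * ∑ e : Fin n ↪ Fin N, Complex.exp (Complex.I * μ * ((t : ℂ) - (y : ℂ))) *
            eHatMinus μ e f (Fin.snoc (Function.update x k y) (x k)) := fun y => by
      simp only [bMinus, Finset.mul_sum, mul_left_comm _ ((γ : ℂ) ^ _)]
    simp only [hexp]
    have hterm : ∀ n : ℕ, Continuous fun y : ℝ => (γ : ℂ) ^ n * ∑ e : Fin n ↪ Fin N,
        Complex.exp (Complex.I * μ * ((t : ℂ) - (y : ℂ))) *
          eHatMinus μ e f (Fin.snoc (Function.update x k y) (x k)) := fun n =>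
      continuous_const.mul (continuous_finsetSum _ fun e _ => hint n e k)
    rw [intervalIntegral.integral_finsetSum fun n _ => (hterm n).intervalIntegrable _ _,
      Finset.sum_range_succ]
    simp only [intervalIntegral.integral_const_mul,
      intervalIntegral.integral_finsetSum fun e _ => (hint _ e k).intervalIntegrable _ _]
    -- The term n = N disappears: a tuple of length N contains every index, in particular k.
    rw [add_eq_left, Finset.sum_eq_zero, mul_zero]
    exact fun e _ => hzero N e k (Finite.surjective_of_injective e.injective k)
  rw [bMinus, Finset.sum_range_succ', add_comm]
  congr 1
  · simp [eHatMinus_zero]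
  · simp only [hsum]
    rw [Finset.sum_comm, Finset.mul_sum]
    refine Finset.sum_congr rfl fun n _ => ?_
    rw [← Finset.mul_sum, pow_succ', mul_assoc, Finset.sum_comm]
    congr 2
    -- A tuple of length n + 1 is its tail together with a first entry outside the range of the
    -- tail.
    rw [← (Equiv.embeddingFinSucc n (Fin N)).symm.sum_comp, Fintype.sum_sigma]
    refine Finset.sum_congr rfl fun e _ => ?_
    have hs : ∀ k : {k // k ∉ Set.range e}, eHatMinus μ
        ((Equiv.embeddingFinSucc n (Fin N)).symm ⟨e, k⟩) f (Fin.snoc x t) =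
        ∫ y in (x k)..(max (x k) t), Complex.exp (Complex.I * μ * ((t : ℂ) - (y : ℂ))) *
          eHatMinus μ e f (Fin.snoc (Function.update x k y) (x k)) := fun k => by
      set e₁ := (Equiv.embeddingFinSucc n (Fin N)).symm ⟨e, k⟩ with h₁
      have h₂ : Equiv.embeddingFinSucc n (Fin N) e₁ = ⟨e, k⟩ := Equiv.apply_symm_apply _ _
      have h₃ := Equiv.embeddingFinSucc_fst e₁
      have h₄ := Equiv.embeddingFinSucc_snd e₁
      rw [h₂] at h₃ h₄
      rw [eHatMinus_succ μ e₁ e (fun m => congrFun h₃ m)]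
      simp only at h₄
      rw [← h₄]
    simp only [hs]
    rw [← Finset.sum_subtype (Finset.univ.filter fun k => k ∉ Set.range e) (by simp)
      fun k => ∫ y in (x k)..(max (x k) t), Complex.exp (Complex.I * μ * ((t : ℂ) - (y : ℂ))) *
          eHatMinus μ e f (Fin.snoc (Function.update x k y) (x k))]
    exact Finset.sum_filter_of_ne fun k _ hk he => hk (hzero n e k he)

/-! ### Linearity and permutation equivariance of b^- -/

theorem intervalIntegral_linear (c d : ℂ) {f g : ℝ → ℂ} (hf : Continuous f) (hg : Continuous g)
    (a b : ℝ) :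
    ∫ y in a..b, (c * f y + d * g y) = c * (∫ y in a..b, f y) + d * ∫ y in a..b, g y := by
  rw [← intervalIntegral.integral_const_mul, ← intervalIntegral.integral_const_mul,
    ← intervalIntegral.integral_add ((continuous_const.fun_mul hf).intervalIntegrable _ _)
      ((continuous_const.fun_mul hg).intervalIntegrable _ _)]

theorem bMinus_linear {N : ℕ} (γ : ℝ) (μ a b : ℂ) {f g : (Fin N → ℝ) → ℂ} (hf : Continuous f)
    (hg : Continuous g) (x : Fin (N + 1) → ℝ) :
    bMinus γ μ (fun v => a * f v + b * g v) x = a * bMinus γ μ f x + b * bMinus γ μ g x := by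
  have h : ∀ (n : ℕ) (i : Fin n ↪ Fin N), eHatMinus μ i (fun v => a * f v + b * g v) x
      = a * eHatMinus μ i f x + b * eHatMinus μ i g x := by
    intro n i
    rw [← Fin.snoc_init_self x]
    simp only [eHatMinus_snoc]
    have hc : ∀ f : (Fin N → ℝ) → ℂ, Continuous f → Continuous fun y : Fin n → ℝ =>
        (∏ m, Complex.exp (Complex.I * μ * (((Fin.init x : Fin N → ℝ) (i m) : ℂ) - (y m : ℂ)))) *
          f (replaceCoords i y (Fin.init x)) := fun f hf =>
      Continuous.mul (by fun_prop) (hf.comp (continuous_replaceCoords i continuous_id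
        continuous_const))
    rw [mul_left_comm a, mul_left_comm b, ← mul_add, ← iterIntegral_const_mul a,
      ← iterIntegral_const_mul b, ← iterIntegral_add _ _ _ _ (continuous_const.fun_mul (hc f hf))
      (continuous_const.fun_mul (hc g hg))]
    congr 1
    refine iterIntegral_congr fun y => ?_
    ring
  simp only [bMinus, h, Finset.sum_add_distrib, mul_add, Finset.mul_sum]
  simp only [mul_left_comm]

theorem replaceCoords_comp {N n : ℕ} (i : Fin n ↪ Fin N) (σ : Equiv.Perm (Fin N)) (y : Fin n → ℝ)
    (x : Fin N → ℝ) :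
    replaceCoords i y (x ∘ σ) = replaceCoords (i.trans σ.toEmbedding) y x ∘ σ := by
  funext k
  by_cases h : ∃ m, i m = k
  · obtain ⟨m, rfl⟩ := h
    have h' : σ (i m) = (i.trans σ.toEmbedding) m := rfl
    rw [Function.comp_apply, h', replaceCoords, replaceCoords, i.injective.extend_apply,
      (i.trans σ.toEmbedding).injective.extend_apply]
  · rw [Function.comp_apply, replaceCoords, replaceCoords, Function.extend_apply' _ _ _ h,
      Function.extend_apply']
    · rfl
    · rintro ⟨m, hm⟩
      exact h ⟨m, σ.injective hm⟩

/-- The sum runs over all index tuples, so relabelling them by σ moves the permutation from the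
point to the function. -/
theorem bMinus_comp {N : ℕ} (γ : ℝ) (μ : ℂ) (f : (Fin N → ℝ) → ℂ) (σ : Equiv.Perm (Fin N))
    (x : Fin N → ℝ) (t : ℝ) :
    bMinus γ μ f (Fin.snoc (x ∘ σ) t) = bMinus γ μ (fun v => f (v ∘ σ)) (Fin.snoc x t) := by
  refine Finset.sum_congr rfl fun n _ => congrArg _ ?_
  refine Fintype.sum_equiv ((Equiv.refl (Fin n)).embeddingCongr σ) _ _ fun i => ?_
  have h : (Equiv.refl (Fin n)).embeddingCongr σ i = i.trans σ.toEmbedding := by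
    ext m; rfl
  rw [h, eHatMinus_snoc, eHatMinus_snoc]
  simp only [replaceCoords_comp]
  rfl

/-! ### Two successive operators b^- -/

theorem exp_mul_primitive (α : ℂ) {h : ℝ → ℂ} (hh : Continuous h) {u a t : ℝ} (hua : u ≤ a) :
    Complex.exp (α * t) * ∫ y in a..(max a t), h y
      = (∫ y in a..(max a t), Complex.exp (α * y) * h y) +
        α * ∫ y in u..t, Complex.exp (α * y) * ∫ z in a..(max a y), h z := by
  have hprim : Continuous fun y : ℝ => ∫ z in a..(max a y), h z :=
    intervalIntegral.continuous_parametric_intervalIntegral_of_continuous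
      (f := fun _ z => h z) (hh.comp continuous_snd) (continuous_const.max continuous_id)
  have hexp : Continuous fun y : ℝ => Complex.exp (α * y) := by fun_prop
  -- The inner integral is zero for y ≤ a, so the lower limit u contributes nothing; above a the
  -- claim is integration by parts.
  have hlow : ∀ b ≤ a, ∫ y in u..b, Complex.exp (α * y) * ∫ z in a..(max a y), h z = 0 := by
    intro b hb
    rw [← intervalIntegral.integral_zero (a := u) (b := b) (μ := MeasureTheory.volume)]
    refine intervalIntegral.integral_congr fun y hy => ?_
    have hy' : y ≤ a := hy.2.trans (max_le hua hb)
    simp [max_eq_left hy']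
  rcases le_total t a with hta | hat
  · rw [hlow t hta]
    simp [max_eq_left hta]
  · rw [max_eq_right hat, ← intervalIntegral.integral_add_adjacent_intervals
      ((hexp.fun_mul hprim).intervalIntegrable u a) ((hexp.fun_mul hprim).intervalIntegrable a t),
      hlow a le_rfl, zero_add]
    have h1 : ∫ y in a..t, Complex.exp (α * y) * ∫ z in a..(max a y), h z
        = ∫ y in a..t, Complex.exp (α * y) * ∫ z in a..y, h z := by
      refine intervalIntegral.integral_congr fun y hy => ?_
      rw [Set.uIcc_of_le hat] at hy
      simp [max_eq_right hy.1]
    have h2 := intervalIntegral.integral_mul_deriv_eq_deriv_mul (a := a) (b := t)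
      (u := fun y : ℝ => Complex.exp (α * y)) (u' := fun y : ℝ => Complex.exp (α * y) * α)
      (v := fun y => ∫ z in a..y, h z) (v' := h)
      (fun y _ => by
        have := ((hasDerivAt_id (y : ℂ)).const_mul α).cexp.comp_ofReal
        simpa using this)
      (fun y _ => intervalIntegral.integral_hasDerivAt_right (hh.intervalIntegrable _ _)
        hh.stronglyMeasurable.stronglyMeasurableAtFilter hh.continuousAt)
      ((hexp.mul continuous_const).intervalIntegrable _ _) (hh.intervalIntegrable _ _)
    have h3 : ∀ y : ℝ, Complex.exp (α * y) * α * (∫ z in a..y, h z)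
        = α * (Complex.exp (α * y) * ∫ z in a..y, h z) := fun y => by ring
    simp only [h3, intervalIntegral.integral_const_mul, intervalIntegral.integral_same] at h2
    rw [h1]
    linear_combination -h2

/-- Transport of the last variable of `b^-_κ f` along an exponential with a different frequency. -/
theorem bMinus_snoc_shift {N : ℕ} (γ : ℝ) (κ μ : ℂ) {f : (Fin N → ℝ) → ℂ} (hf : Continuous f)
    (x : Fin N → ℝ) (u t : ℝ) (hu : ∀ k, u ≤ x k) :
    bMinus γ κ f (Fin.snoc x t) =
      Complex.exp (Complex.I * μ * ((t : ℂ) - (u : ℂ))) * (Complex.exp (Complex.I * κ * u) * f x) +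
      γ * (∑ k, ∫ y in (x k)..(max (x k) t), Complex.exp (Complex.I * μ * ((t : ℂ) - (y : ℂ))) *
        bMinus γ κ f (Fin.snoc (Function.update x k y) (x k))) +
      Complex.I * (κ - μ) * ∫ y in u..t, Complex.exp (Complex.I * μ * ((t : ℂ) - (y : ℂ))) *
        bMinus γ κ f (Fin.snoc x y) := by
  set α := Complex.I * (κ - μ) with hα
  -- With e^{iκt} taken out, the recursion writes b^-_κ f as f x plus γ times primitives of the G k.
  -- Changing the frequency from κ to μ multiplies these by e^{αt}, and integration by parts yields
  -- the correction term with factor α.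
  set G : Fin N → ℝ → ℂ := fun k y => Complex.exp (-(Complex.I * κ * y)) *
    bMinus γ κ f (Fin.snoc (Function.update x k y) (x k)) with hG
  have hGc : ∀ k, Continuous (G k) := fun k => Continuous.mul (by fun_prop)
    ((continuous_bMinus γ κ hf).comp
      (continuous_finSnoc (continuous_const.update k continuous_id) continuous_const))
  have hR : ∀ y : ℝ, bMinus γ κ f (Fin.snoc x y) = Complex.exp (Complex.I * κ * y) *
      (f x + γ * ∑ k, ∫ z in (x k)..(max (x k) y), G k z) := by
    intro y
    rw [bMinus_snoc γ κ hf x y, mul_add, mul_left_comm _ (γ : ℂ),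
      Finset.mul_sum _ _ (Complex.exp _)]
    refine congrArg₂ _ rfl (congrArg _ (Finset.sum_congr rfl fun k _ => ?_))
    rw [← intervalIntegral.integral_const_mul]
    refine intervalIntegral.integral_congr fun z _ => ?_
    simp only [hG]
    rw [← mul_assoc, ← Complex.exp_add]
    ring_nf
  have hprim : ∀ k, Continuous fun y : ℝ => ∫ z in (x k)..(max (x k) y), G k z := fun k =>
    intervalIntegral.continuous_parametric_intervalIntegral_of_continuous
      (f := fun _ z => G k z) ((hGc k).comp continuous_snd) (continuous_const.max continuous_id)
  have hexp : Continuous fun y : ℝ => Complex.exp (α * y) := by fun_prop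
  have h1 : ∫ y in u..t, Complex.exp (Complex.I * μ * ((t : ℂ) - (y : ℂ))) *
        bMinus γ κ f (Fin.snoc x y) = Complex.exp (Complex.I * μ * t) *
        ((∫ y in u..t, Complex.exp (α * y)) * f x + γ * ∑ k, ∫ y in u..t,
          Complex.exp (α * y) * ∫ z in (x k)..(max (x k) y), G k z) := by
    rw [← intervalIntegral.integral_finsetSum fun k _ =>
      (hexp.fun_mul (hprim k)).intervalIntegrable _ _, mul_comm _ (f x),
      ← intervalIntegral_linear _ _ hexp (continuous_finsetSum _ fun k _ => hexp.fun_mul (hprim k)),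
      ← intervalIntegral.integral_const_mul]
    refine intervalIntegral.integral_congr fun y _ => ?_
    rw [hR, ← mul_assoc, ← Complex.exp_add, ← Finset.mul_sum, mul_left_comm (γ : ℂ),
      mul_comm (f x), ← mul_add, ← mul_assoc, ← Complex.exp_add, hα]
    ring_nf
  have h2 : ∀ k, (∫ y in (x k)..(max (x k) t),
      Complex.exp (Complex.I * μ * ((t : ℂ) - (y : ℂ))) *
        bMinus γ κ f (Fin.snoc (Function.update x k y) (x k)))
      = Complex.exp (Complex.I * μ * t) *
        ∫ y in (x k)..(max (x k) t), Complex.exp (α * y) * G k y := by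
    intro k
    rw [← intervalIntegral.integral_const_mul]
    refine intervalIntegral.integral_congr fun y _ => ?_
    simp only [hG]
    rw [← mul_assoc, ← mul_assoc, ← Complex.exp_add, ← Complex.exp_add, hα]
    ring_nf
  have h3 : Complex.exp (α * t) = Complex.exp (α * u) + α * ∫ y in u..t, Complex.exp (α * y) := by
    have h := intervalIntegral.integral_eq_sub_of_hasDerivAt (a := u) (b := t)
      (f := fun y : ℝ => Complex.exp (α * y)) (f' := fun y : ℝ => α * Complex.exp (α * y))
      (fun y _ => by
        have := ((hasDerivAt_id (y : ℂ)).const_mul α).cexp.comp_ofReal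
        simpa [mul_comm] using this)
      ((continuous_const.mul hexp).intervalIntegrable _ _)
    rw [intervalIntegral.integral_const_mul] at h
    rw [h]; ring
  have h4 : ∀ k, Complex.exp (α * t) * ∫ y in (x k)..(max (x k) t), G k y
      = _ := fun k => exp_mul_primitive α (hGc k) (hu k)
  have h5 : Complex.exp (Complex.I * μ * ((t : ℂ) - (u : ℂ))) * (Complex.exp (Complex.I * κ * u) * f x)
      = Complex.exp (Complex.I * μ * t) * (Complex.exp (α * u) * f x) := by
    rw [← mul_assoc, ← mul_assoc, ← Complex.exp_add, ← Complex.exp_add, hα]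
    ring_nf
  have h6 : Complex.exp (Complex.I * κ * t) = Complex.exp (Complex.I * μ * t) * Complex.exp (α * t) := by
    rw [← Complex.exp_add, hα]
    ring_nf
  rw [hR, h6, h1, h5]
  simp only [h2]
  rw [mul_assoc, mul_add, mul_left_comm _ (γ : ℂ), Finset.mul_sum]
  simp only [h4]
  rw [Finset.sum_add_distrib, ← Finset.mul_sum, ← Finset.mul_sum, h3]
  ring

/-- Both sides satisfy the recursion of b^-_μ in t. On the left, the lowest coordinate u adds one
integral over [u, t]; on the right, b^-_κ f obeys the recursion with frequency μ only up to the
correction of `bMinus_snoc_shift`. The coefficient -iγ/(κ - μ) is the one that makes these extra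
terms equal. -/
theorem bMinus_bMinus_of_le {M : ℕ} (γ : ℝ) {κ μ : ℂ} (hne : κ ≠ μ) {f : (Fin M → ℝ) → ℂ}
    (hf : Continuous f) (u : ℝ) : ∀ (x : Fin M → ℝ) (t : ℝ), (∀ k, u ≤ x k) → u ≤ t →
    bMinus γ μ (bMinus γ κ f) (Fin.snoc (Fin.snoc x u : Fin (M + 1) → ℝ) t)
      = (1 - -Complex.I * γ / (κ - μ)) *
          (Complex.exp (Complex.I * κ * u) * bMinus γ μ f (Fin.snoc x t)) +
        -Complex.I * γ / (κ - μ) *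
          (Complex.exp (Complex.I * μ * u) * bMinus γ κ f (Fin.snoc x t)) := by
  classical
  -- Induction on the number of coordinates below t. In the recursive term t becomes x k and x k
  -- becomes some y ≥ x k, so the index k is no longer counted.
  suffices H : ∀ (r : ℕ) (x : Fin M → ℝ) (t : ℝ), (Finset.univ.filter fun k => x k < t).card < r →
      (∀ k, u ≤ x k) → u ≤ t →
      bMinus γ μ (bMinus γ κ f) (Fin.snoc (Fin.snoc x u : Fin (M + 1) → ℝ) t)
        = (1 - -Complex.I * γ / (κ - μ)) *
            (Complex.exp (Complex.I * κ * u) * bMinus γ μ f (Fin.snoc x t)) +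
          -Complex.I * γ / (κ - μ) *
            (Complex.exp (Complex.I * μ * u) * bMinus γ κ f (Fin.snoc x t)) from
    fun x t => H _ x t (Nat.lt_succ_self _)
  intro r
  induction r with
  | zero => intro _ _ h; exact absurd h (Nat.not_lt_zero _)
  | succ r ih =>
    intro x t hr hx ht
    set c := -Complex.I * γ / (κ - μ) with hc
    have hcγ : c * (Complex.I * (κ - μ)) = γ := by
      have : κ - μ ≠ 0 := sub_ne_zero.2 hne
      rw [hc]; field_simp; simp
    have hint : ∀ (ν : ℂ) (k : Fin M), Continuous fun y : ℝ =>
        Complex.exp (Complex.I * μ * ((t : ℂ) - (y : ℂ))) *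
          bMinus γ ν f (Fin.snoc (Function.update x k y) (x k)) := fun ν k =>
      Continuous.mul (by fun_prop) ((continuous_bMinus γ ν hf).comp
        (continuous_finSnoc (continuous_const.update k continuous_id) continuous_const))
    have hk : ∀ k, (∫ y in (x k)..(max (x k) t),
        Complex.exp (Complex.I * μ * ((t : ℂ) - (y : ℂ))) * bMinus γ μ (bMinus γ κ f)
          (Fin.snoc (Fin.snoc (Function.update x k y) u : Fin (M + 1) → ℝ) (x k)))
        = (1 - c) * Complex.exp (Complex.I * κ * u) * (∫ y in (x k)..(max (x k) t),
          Complex.exp (Complex.I * μ * ((t : ℂ) - (y : ℂ))) *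
            bMinus γ μ f (Fin.snoc (Function.update x k y) (x k))) +
          c * Complex.exp (Complex.I * μ * u) * (∫ y in (x k)..(max (x k) t),
          Complex.exp (Complex.I * μ * ((t : ℂ) - (y : ℂ))) *
            bMinus γ κ f (Fin.snoc (Function.update x k y) (x k))) := by
      intro k
      rcases le_or_gt t (x k) with h | h
      · simp [max_eq_left h]
      rw [← intervalIntegral_linear _ _ (hint _ k) (hint _ k)]
      refine intervalIntegral.integral_congr fun y hy => ?_
      rw [Set.uIcc_of_le (le_max_left _ _)] at hy
      rw [ih (Function.update x k y) (x k) ?_ ?_ (hx k)]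
      · ring
      · refine lt_of_lt_of_le (Finset.card_lt_card ?_) (Nat.lt_succ_iff.1 hr)
        refine Finset.ssubset_iff_subset_ne.2 ⟨fun j hj => ?_, fun he => ?_⟩
        · simp only [Finset.mem_filter, Finset.mem_univ, true_and] at hj ⊢
          by_cases hjk : j = k
          · rw [hjk]; exact h
          · rw [Function.update_of_ne hjk] at hj
            exact hj.trans h
        · have : k ∈ Finset.univ.filter fun k => x k < t := by simpa using h
          rw [← he] at this
          simp only [Finset.mem_filter, Finset.mem_univ, true_and, Function.update_self] at this
          linarith [hy.1]
      · intro j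
        by_cases hjk : j = k
        · rw [hjk, Function.update_self]
          exact (hx k).trans hy.1
        · rw [Function.update_of_ne hjk]
          exact hx j
    -- At (x, y, u) the last entry u is the lowest, so the outer b^-_μ reduces to a factor e^{iμu}.
    have hlast : (∫ y in u..t, Complex.exp (Complex.I * μ * ((t : ℂ) - (y : ℂ))) *
        bMinus γ μ (bMinus γ κ f) (Fin.snoc (Fin.snoc x y : Fin (M + 1) → ℝ) u))
        = Complex.exp (Complex.I * μ * u) * ∫ y in u..t,
          Complex.exp (Complex.I * μ * ((t : ℂ) - (y : ℂ))) * bMinus γ κ f (Fin.snoc x y) := by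
      rw [← intervalIntegral.integral_const_mul]
      refine intervalIntegral.integral_congr fun y hy => ?_
      rw [Set.uIcc_of_le ht] at hy
      rw [bMinus_of_le γ μ (bMinus γ κ f)]
      · ring
      · refine Fin.lastCases ?_ fun j => ?_
        · simpa using hy.1
        · simpa using hx j
    rw [bMinus_snoc γ μ (continuous_bMinus γ κ hf), Fin.sum_univ_castSucc]
    simp only [Fin.snoc_castSucc, Fin.snoc_last, Fin.update_snoc_last, ← Fin.snoc_update]
    simp only [hk]
    rw [max_eq_right ht, hlast, bMinus_of_le γ κ f x u hx, Finset.sum_add_distrib,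
      ← Finset.mul_sum, ← Finset.mul_sum]
    have hP := bMinus_snoc γ μ hf x t
    have hQ := bMinus_snoc_shift γ κ μ hf x u t hx
    have he : Complex.exp (Complex.I * μ * ((t : ℂ) - (u : ℂ))) * Complex.exp (Complex.I * μ * u)
        = Complex.exp (Complex.I * μ * t) := by
      rw [← Complex.exp_add]; ring_nf
    linear_combination (-(1 - c) * Complex.exp (Complex.I * κ * u)) * hP
      - c * Complex.exp (Complex.I * μ * u) * hQ
      - c * Complex.exp (Complex.I * κ * u) * f x * he
      - (Complex.exp (Complex.I * μ * u) * ∫ y in u..t,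
          Complex.exp (Complex.I * μ * ((t : ℂ) - (y : ℂ))) * bMinus γ κ f (Fin.snoc x y)) * hcγ

/-! ### The wavefunctions generated by `b^-` and the exchange relations -/

/-- The function obtained from the constant `1` by successive application of the operators
`b^-_{λ_1}, ..., b^-_{λ_N}`. -/
def recWave (γ : ℝ) : (N : ℕ) → (Fin N → ℂ) → (Fin N → ℝ) → ℂ
  | 0, _ => fun _ => 1
  | N + 1, lam => bMinus γ (lam (Fin.last N)) (recWave γ N (Fin.init lam))

theorem recWave_snoc (γ : ℝ) {N : ℕ} (lam : Fin N → ℂ) (μ : ℂ) :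
    recWave γ (N + 1) (Fin.snoc lam μ) = bMinus γ μ (recWave γ N lam) := by
  rw [recWave, Fin.snoc_last, Fin.init_snoc]

theorem continuous_recWave (γ : ℝ) {N : ℕ} (lam : Fin N → ℂ) : Continuous (recWave γ N lam) := by
  induction N with
  | zero => exact continuous_const
  | succ N ih => exact continuous_bMinus _ _ (ih _)

theorem recWave_snoc_of_le (γ : ℝ) {N : ℕ} (lam : Fin N → ℂ) (μ : ℂ) (x : Fin N → ℝ) (t : ℝ)
    (h : ∀ k, t ≤ x k) :
    recWave γ (N + 1) (Fin.snoc lam μ) (Fin.snoc x t)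
      = Complex.exp (Complex.I * μ * t) * recWave γ N lam x := by
  rw [recWave_snoc, bMinus_of_le _ _ _ _ _ h]

theorem antitone_init {N : ℕ} {x : Fin (N + 1) → ℝ} (hx : Antitone x) :
    Antitone (Fin.init x : Fin N → ℝ) :=
  fun _ _ h => hx (Fin.castSucc_le_castSucc_iff.2 h)

theorem recWave_of_antitone (γ : ℝ) {N : ℕ} (lam : Fin N → ℂ) {x : Fin N → ℝ} (hx : Antitone x) :
    recWave γ N lam x = planeWave lam x := by
  induction N with
  | zero => simp [recWave, planeWave]
  | succ N ih =>
    rw [← Fin.snoc_init_self lam, ← Fin.snoc_init_self x, recWave_snoc_of_le,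
      ih _ (antitone_init hx), planeWave, planeWave, ← Complex.exp_add, Fin.sum_univ_castSucc]
    · simp only [Fin.snoc_castSucc, Fin.snoc_last]
      ring_nf
    · exact fun k => hx (Fin.le_last _)

/-- The coefficient `-iγ / (a - b)` of the exchange relations. -/
def exchangeCoeff (γ : ℝ) (a b : ℂ) : ℂ := -Complex.I * γ / (a - b)

theorem exchangeCoeff_swap (γ : ℝ) (a b : ℂ) : exchangeCoeff γ b a = -exchangeCoeff γ a b := by
  rw [exchangeCoeff, exchangeCoeff, ← neg_sub a b, div_neg]

/-- Partial fractions; this is the Yang–Baxter type identity behind the braid hexagon. -/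
theorem exchangeCoeff_mul (γ : ℝ) {a b c : ℂ} (hab : a ≠ b) (hbc : b ≠ c) (hac : a ≠ c) :
    exchangeCoeff γ a b * exchangeCoeff γ b c
      = exchangeCoeff γ a c * (exchangeCoeff γ a b + exchangeCoeff γ b c) := by
  have h1 := sub_ne_zero.2 hab
  have h2 := sub_ne_zero.2 hbc
  have h3 := sub_ne_zero.2 hac
  simp only [exchangeCoeff]
  field_simp
  ring

/-- Every point is obtained from a decreasing one by adjacent transpositions. -/
theorem induction_of_antitone {N : ℕ} {p : (Fin N → ℝ) → Prop} (h0 : ∀ x, Antitone x → p x)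
    (h1 : ∀ x (j : Fin (N - 1)), p x → p (x ∘ simpleSwap j)) (x : Fin N → ℝ) : p x := by
  have h2 : ∀ (l : List (Fin (N - 1))) (y : Fin N → ℝ), p y → p (y ∘ (l.map simpleSwap).prod) := by
    intro l
    induction l with
    | nil => exact fun y hy => hy
    | cons j l ih =>
      intro y hy
      have := ih _ (h1 y j hy)
      rwa [Function.comp_assoc, ← Equiv.Perm.coe_mul, ← List.prod_cons, ← List.map_cons] at this
  set σ := Tuple.sort fun k => -x k
  have hσ : Antitone (x ∘ σ) := fun a b hab =>
    neg_le_neg_iff.1 (Tuple.monotone_sort (fun k => -x k) hab)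
  obtain ⟨l, hl⟩ := exists_word σ⁻¹
  have := h2 l _ (h0 _ hσ)
  rwa [hl, Function.comp_assoc, ← Equiv.Perm.coe_mul, mul_inv_cancel, Equiv.Perm.coe_one,
    Function.comp_id] at this

theorem snoc_comp_simpleSwap {M : ℕ} {α : Type*} (x : Fin (M + 1) → α) (t : α) (j : Fin M) :
    (Fin.snoc x t : Fin (M + 2) → α) ∘ simpleSwap (N := M + 2) (Fin.castSucc j)
      = Fin.snoc (x ∘ simpleSwap (N := M + 1) j) t := by
  have hl : leftPos (N := M + 2) (Fin.castSucc j) = (leftPos (N := M + 1) j).castSucc := rfl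
  have hr : rightPos (N := M + 2) (Fin.castSucc j) = (rightPos (N := M + 1) j).castSucc := rfl
  funext k
  rw [Function.comp_apply, simpleSwap, hl, hr]
  refine Fin.lastCases ?_ (fun k => ?_) k
  · rw [Equiv.swap_apply_of_ne_of_ne (Fin.castSucc_ne_last _).symm (Fin.castSucc_ne_last _).symm]
    simp
  · rw [(Fin.castSucc_injective _).swap_apply]
    simp [simpleSwap]

theorem snoc_snoc_comp_simpleSwap {M : ℕ} {α : Type*} (x : Fin M → α) (s t : α) :
    (Fin.snoc (Fin.snoc x s : Fin (M + 1) → α) t : Fin (M + 2) → α) ∘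
        simpleSwap (N := M + 2) (Fin.last M) = Fin.snoc (Fin.snoc x t : Fin (M + 1) → α) s := by
  have hl : leftPos (N := M + 2) (Fin.last M) = (Fin.last M).castSucc := rfl
  have hr : rightPos (N := M + 2) (Fin.last M) = Fin.last (M + 1) := rfl
  funext k
  rw [Function.comp_apply, simpleSwap, hl, hr]
  refine Fin.lastCases ?_ (fun k => ?_) k
  · simp
  · refine Fin.lastCases ?_ (fun k => ?_) k
    · simp
    · rw [Equiv.swap_apply_of_ne_of_ne]
      · simp
      · exact fun h => Fin.castSucc_ne_last k (Fin.castSucc_injective _ h)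
      · exact Fin.castSucc_ne_last _

/-- The exchange relations in `N` variables. -/
def Exchange (γ : ℝ) (N : ℕ) : Prop :=
  ∀ lam : Fin N → ℂ, Function.Injective lam → ∀ (j : Fin (N - 1)) (x : Fin N → ℝ),
    recWave γ N lam (x ∘ simpleSwap j) =
      (1 - exchangeCoeff γ (lam (leftPos j)) (lam (rightPos j))) *
        recWave γ N (lam ∘ simpleSwap j) x +
      exchangeCoeff γ (lam (leftPos j)) (lam (rightPos j)) * recWave γ N lam x

/-- b^-_μ is linear and commutes with permutations of the first N variables, so relations among
these survive the adjunction of a variable. -/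
theorem Exchange.snoc {γ : ℝ} {N : ℕ} (hE : Exchange γ N) {lam : Fin N → ℂ}
    (hlam : Function.Injective lam) (μ : ℂ) (j : Fin (N - 1)) (x : Fin N → ℝ) (t : ℝ) :
    recWave γ (N + 1) (Fin.snoc lam μ) (Fin.snoc (x ∘ simpleSwap j) t) =
      (1 - exchangeCoeff γ (lam (leftPos j)) (lam (rightPos j))) *
        recWave γ (N + 1) (Fin.snoc (lam ∘ simpleSwap j) μ) (Fin.snoc x t) +
      exchangeCoeff γ (lam (leftPos j)) (lam (rightPos j)) *
        recWave γ (N + 1) (Fin.snoc lam μ) (Fin.snoc x t) := by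
  simp only [recWave_snoc]
  rw [bMinus_comp]
  simp only [hE lam hlam j]
  rw [bMinus_linear _ _ _ _ (continuous_recWave _ _) (continuous_recWave _ _)]

/-! ### The exchange relation for the last two variables -/

section LastExchange

variable (γ : ℝ) {M : ℕ} {lam : Fin M → ℂ} {a b : ℂ}

theorem recWave_snoc_snoc_of_le (hab : a ≠ b) (x : Fin M → ℝ) (u t : ℝ) (hx : ∀ k, u ≤ x k)
    (ht : u ≤ t) :
    recWave γ (M + 2) (Fin.snoc (Fin.snoc lam a : Fin (M + 1) → ℂ) b)
        (Fin.snoc (Fin.snoc x u : Fin (M + 1) → ℝ) t)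
      = (1 - exchangeCoeff γ a b) * (Complex.exp (Complex.I * a * u) *
          recWave γ (M + 1) (Fin.snoc lam b) (Fin.snoc x t)) +
        exchangeCoeff γ a b * (Complex.exp (Complex.I * b * u) *
          recWave γ (M + 1) (Fin.snoc lam a) (Fin.snoc x t)) := by
  simp only [recWave_snoc]
  exact bMinus_bMinus_of_le γ hab (continuous_recWave _ _) u x t hx ht

/-- The exchange relation for the last two variables at `(x, s, t)`. -/
def LastExchange (lam : Fin M → ℂ) (a b : ℂ) (x : Fin M → ℝ) (s t : ℝ) : Prop :=
  recWave γ (M + 2) (Fin.snoc (Fin.snoc lam a : Fin (M + 1) → ℂ) b)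
      (Fin.snoc (Fin.snoc x t : Fin (M + 1) → ℝ) s) =
    (1 - exchangeCoeff γ a b) * recWave γ (M + 2) (Fin.snoc (Fin.snoc lam b : Fin (M + 1) → ℂ) a)
      (Fin.snoc (Fin.snoc x s : Fin (M + 1) → ℝ) t) +
    exchangeCoeff γ a b * recWave γ (M + 2) (Fin.snoc (Fin.snoc lam a : Fin (M + 1) → ℂ) b)
      (Fin.snoc (Fin.snoc x s : Fin (M + 1) → ℝ) t)

theorem le_snoc {x : Fin M → ℝ} {u t : ℝ} (hx : ∀ k, u ≤ x k) (ht : u ≤ t) :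
    ∀ k, u ≤ (Fin.snoc x t : Fin (M + 1) → ℝ) k := by
  refine Fin.lastCases ?_ fun k => ?_
  · simpa using ht
  · simpa using hx k

theorem lastExchange_of_le_right (hab : a ≠ b) (x : Fin M → ℝ) (s t : ℝ) (hx : ∀ k, t ≤ x k)
    (hs : t ≤ s) : LastExchange γ lam a b x s t := by
  rw [LastExchange, recWave_snoc_snoc_of_le γ hab x t s hx hs,
    recWave_snoc_of_le _ _ _ _ _ (le_snoc hx hs), recWave_snoc_of_le _ _ _ _ _ (le_snoc hx hs)]

/-- Both terms on the right split by the two-step formula; since the coefficient changes sign with a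
and b, the e^{ias} parts cancel and the others add up to coefficient 1. -/
theorem lastExchange_of_le_left (hab : a ≠ b) (x : Fin M → ℝ) (s t : ℝ) (hx : ∀ k, s ≤ x k)
    (ht : s ≤ t) : LastExchange γ lam a b x s t := by
  rw [LastExchange, recWave_snoc_snoc_of_le γ hab x s t hx ht,
    recWave_snoc_snoc_of_le γ hab.symm x s t hx ht,
    recWave_snoc_of_le _ _ _ _ _ (le_snoc hx ht), exchangeCoeff_swap γ a b]
  ring

end LastExchange

/-- Five edges of the braid hexagon imply the sixth. -/
theorem exchange_hexagon (γ : ℝ) (W : ℂ → ℂ → ℂ → ℝ → ℝ → ℝ → ℂ) {D : ℂ → ℂ → ℂ → Prop}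
    (hD₁ : ∀ a b c, D a b c → D b a c) (hD₂ : ∀ a b c, D a b c → D a c b)
    (hne : ∀ a b c, D a b c → a ≠ b ∧ b ≠ c ∧ a ≠ c) (s t v : ℝ)
    (h₁ : ∀ a b c, D a b c → ∀ p q r, W a b c q p r =
      (1 - exchangeCoeff γ a b) * W b a c p q r + exchangeCoeff γ a b * W a b c p q r)
    (h₂ : ∀ a b c, D a b c → ∀ p r, v ≤ p → v ≤ r → W a b c p v r =
      (1 - exchangeCoeff γ b c) * W a c b p r v + exchangeCoeff γ b c * W a b c p r v)
    (hs : v ≤ s) (ht : v ≤ t) (a b c : ℂ) (h : D a b c) :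
    W a b c v t s = (1 - exchangeCoeff γ b c) * W a c b v s t +
      exchangeCoeff γ b c * W a b c v s t := by
  obtain ⟨hab, hbc, hac⟩ := hne a b c h
  have hbac := hD₁ _ _ _ h
  have hacb := hD₂ _ _ _ h
  have hbca := hD₂ _ _ _ hbac
  have hcab := hD₁ _ _ _ hacb
  have E := exchangeCoeff_mul γ hab hbc hac
  -- The values at (v, t, s) and (v, s, t) are carried through (t, v, s), (t, s, v) and (s, v, t) to
  -- (s, t, v). What remains is an identity between coefficients of values at (s, t, v), a multiple
  -- of `E`.
  rw [h₁ a b c h t v s, h₁ a c b hacb s v t, h₁ a b c h s v t, h₂ b a c hbac t s ht hs,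
    h₂ a b c h t s ht hs, h₂ c a b hcab s t hs ht, h₂ a c b hacb s t hs ht,
    h₂ b a c hbac s t hs ht, h₂ a b c h s t hs ht, h₁ b c a hbca s t v, h₁ b a c hbac s t v,
    h₁ a c b hacb s t v, h₁ a b c h s t v, exchangeCoeff_swap γ a b, exchangeCoeff_swap γ b c]
  linear_combination ((exchangeCoeff γ a b - exchangeCoeff γ b c) * W a b c s t v +
    (1 - exchangeCoeff γ a b) * W b a c s t v - (1 - exchangeCoeff γ b c) * W a c b s t v) * E

theorem injective_snoc_snoc_swap {M : ℕ} {lam : Fin M → ℂ} {a b : ℂ}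
    (h : Function.Injective (Fin.snoc (Fin.snoc lam a : Fin (M + 1) → ℂ) b : Fin (M + 2) → ℂ)) :
    Function.Injective (Fin.snoc (Fin.snoc lam b : Fin (M + 1) → ℂ) a : Fin (M + 2) → ℂ) := by
  rw [← snoc_snoc_comp_simpleSwap]
  exact h.comp (Equiv.injective _)

theorem injective_of_snoc {M : ℕ} {lam : Fin M → ℂ} {a : ℂ}
    (h : Function.Injective (Fin.snoc lam a : Fin (M + 1) → ℂ)) : Function.Injective lam :=
  (Fin.snoc_injective_iff.1 h).1

theorem ne_of_injective_snoc_snoc {M : ℕ} {lam : Fin M → ℂ} {a b : ℂ}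
    (h : Function.Injective (Fin.snoc (Fin.snoc lam a : Fin (M + 1) → ℂ) b : Fin (M + 2) → ℂ)) :
    a ≠ b := fun hab => (Fin.snoc_injective_iff.1 h).2 ⟨Fin.last M, by simp [hab]⟩

/-- If s or t is the lowest coordinate, the two-step formula applies directly. Otherwise the last
entry v of x lies below both, and the hexagon is used on the last three variables: its first-pair
edges come from the induction hypothesis, its last-pair edges have v as lowest entry. -/
theorem Exchange.lastExchange_of_antitone {γ : ℝ} {M : ℕ} (hE : Exchange γ (M + 1))
    {lam : Fin M → ℂ} {a b : ℂ}
    (h : Function.Injective (Fin.snoc (Fin.snoc lam a : Fin (M + 1) → ℂ) b : Fin (M + 2) → ℂ))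
    {x : Fin M → ℝ} (hx : Antitone x) (s t : ℝ) : LastExchange γ lam a b x s t := by
  have hab := ne_of_injective_snoc_snoc h
  cases M with
  | zero =>
    rcases le_total s t with hst | hst
    · exact lastExchange_of_le_left γ hab x s t (fun k => k.elim0) hst
    · exact lastExchange_of_le_right γ hab x s t (fun k => k.elim0) hst
  | succ M =>
    have hmin : ∀ k, x (Fin.last M) ≤ x k := fun k => hx (Fin.le_last k)
    by_cases h₁ : s ≤ x (Fin.last M) ∧ s ≤ t
    · exact lastExchange_of_le_left γ hab x s t (fun k => h₁.1.trans (hmin k)) h₁.2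
    by_cases h₂ : t ≤ x (Fin.last M) ∧ t ≤ s
    · exact lastExchange_of_le_right γ hab x s t (fun k => h₂.1.trans (hmin k)) h₂.2
    have hv : x (Fin.last M) ≤ s ∧ x (Fin.last M) ≤ t := by grind
    obtain ⟨x, v, rfl⟩ : ∃ (y : Fin M → ℝ) (v : ℝ), x = Fin.snoc y v :=
      ⟨_, _, (Fin.snoc_init_self x).symm⟩
    obtain ⟨lam, c, rfl⟩ : ∃ (y : Fin M → ℂ) (v : ℂ), lam = Fin.snoc y v :=
      ⟨_, _, (Fin.snoc_init_self lam).symm⟩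
    simp only [Fin.snoc_last] at hv hmin
    have hmin' : ∀ k, v ≤ x k := fun k => by simpa using hmin k.castSucc
    refine exchange_hexagon γ (fun a b c p q r => recWave γ (M + 3)
      (Fin.snoc (Fin.snoc (Fin.snoc lam a : Fin (M + 1) → ℂ) b : Fin (M + 2) → ℂ) c)
      (Fin.snoc (Fin.snoc (Fin.snoc x p : Fin (M + 1) → ℝ) q : Fin (M + 2) → ℝ) r))
      (D := fun a b c => Function.Injective
        (Fin.snoc (Fin.snoc (Fin.snoc lam a : Fin (M + 1) → ℂ) b : Fin (M + 2) → ℂ) c :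
          Fin (M + 3) → ℂ)) ?_ (fun a b c => injective_snoc_snoc_swap) ?_ s t v ?_ ?_ hv.1 hv.2 _ _ _ h
    · intro a b c h
      rw [← snoc_snoc_comp_simpleSwap (M := M) lam a b, ← snoc_comp_simpleSwap]
      exact h.comp (Equiv.injective _)
    · intro a b c h
      exact ⟨ne_of_injective_snoc_snoc (injective_of_snoc h), ne_of_injective_snoc_snoc h,
        ne_of_injective_snoc_snoc (injective_of_snoc (injective_snoc_snoc_swap h))⟩
    · intro a b c h p q r
      have := hE.snoc (injective_of_snoc h) c (Fin.last M)
        (Fin.snoc (Fin.snoc x p : Fin (M + 1) → ℝ) q : Fin (M + 2) → ℝ) r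
      rw [snoc_snoc_comp_simpleSwap (M := M) x p q, snoc_snoc_comp_simpleSwap (M := M) lam a b] at this
      have hl : leftPos (N := M + 2) (Fin.last M) = (Fin.last M).castSucc := rfl
      have hr : rightPos (N := M + 2) (Fin.last M) = Fin.last (M + 1) := rfl
      rw [hl, hr] at this
      simpa using this
    · intro a b c h p r hp hr
      exact lastExchange_of_le_right γ (ne_of_injective_snoc_snoc h) _ r v (le_snoc hmin' hp) hr

theorem Exchange.snoc_snoc {γ : ℝ} {M : ℕ} (hE : Exchange γ (M + 1))
    {lam : Fin M → ℂ} {a : ℂ} (h : Function.Injective (Fin.snoc lam a : Fin (M + 1) → ℂ)) (b : ℂ)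
    (j : Fin (M - 1)) (x : Fin M → ℝ) (s t : ℝ) :
    recWave γ (M + 2) (Fin.snoc (Fin.snoc lam a : Fin (M + 1) → ℂ) b)
        (Fin.snoc (Fin.snoc (x ∘ simpleSwap j) s : Fin (M + 1) → ℝ) t) =
      (1 - exchangeCoeff γ (lam (leftPos j)) (lam (rightPos j))) *
        recWave γ (M + 2) (Fin.snoc (Fin.snoc (lam ∘ simpleSwap j) a : Fin (M + 1) → ℂ) b)
          (Fin.snoc (Fin.snoc x s : Fin (M + 1) → ℝ) t) +
      exchangeCoeff γ (lam (leftPos j)) (lam (rightPos j)) *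
        recWave γ (M + 2) (Fin.snoc (Fin.snoc lam a : Fin (M + 1) → ℂ) b)
          (Fin.snoc (Fin.snoc x s : Fin (M + 1) → ℝ) t) := by
  cases M with
  | zero => exact j.elim0
  | succ M =>
    have := hE.snoc h b (Fin.castSucc (n := M) j) (Fin.snoc x s) t
    rw [snoc_comp_simpleSwap (M := M) x s, snoc_comp_simpleSwap (M := M) lam a] at this
    have hl : leftPos (N := M + 2) (Fin.castSucc (n := M) j)
      = (leftPos (N := M + 1) j).castSucc := rfl
    have hr : rightPos (N := M + 2) (Fin.castSucc (n := M) j)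
      = (rightPos (N := M + 1) j).castSucc := rfl
    rw [hl, hr, Fin.snoc_castSucc, Fin.snoc_castSucc] at this
    exact this

/-- Transpositions among the first M variables commute with the last one, so the relation spreads
from decreasing x to every x. -/
theorem Exchange.lastExchange {γ : ℝ} {M : ℕ} (hE : Exchange γ (M + 1)) (x : Fin M → ℝ) :
    ∀ (lam : Fin M → ℂ) (a b : ℂ),
    Function.Injective (Fin.snoc (Fin.snoc lam a : Fin (M + 1) → ℂ) b : Fin (M + 2) → ℂ) →
    ∀ s t : ℝ, LastExchange γ lam a b x s t := by
  induction x using induction_of_antitone with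
  | h0 x hx => exact fun lam a b h s t => hE.lastExchange_of_antitone h hx s t
  | h1 x j ih =>
    intro lam a b h s t
    have h' := injective_snoc_snoc_swap h
    have hj : Function.Injective (Fin.snoc (Fin.snoc (lam ∘ simpleSwap j) a : Fin (M + 1) → ℂ) b :
        Fin (M + 2) → ℂ) := by
      cases M with
      | zero => exact j.elim0
      | succ M =>
        rw [← snoc_comp_simpleSwap (M := M) lam a j, ← snoc_comp_simpleSwap (M := M + 1)]
        exact h.comp (Equiv.injective _)
    have i₁ := ih _ _ _ h s t
    have i₂ := ih _ _ _ hj s t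
    rw [LastExchange] at i₁ i₂ ⊢
    rw [hE.snoc_snoc (injective_of_snoc h), hE.snoc_snoc (injective_of_snoc h),
      hE.snoc_snoc (injective_of_snoc h'), i₁, i₂]
    ring

theorem exchange (γ : ℝ) (N : ℕ) : Exchange γ N := by
  induction N with
  | zero => exact fun _ _ j => j.elim0
  | succ N ih =>
    intro lam hlam j x
    cases N with
    | zero => exact j.elim0
    | succ M =>
      obtain ⟨x, t, rfl⟩ : ∃ (y : Fin (M + 1) → ℝ) (v : ℝ), x = Fin.snoc y v :=
        ⟨_, _, (Fin.snoc_init_self x).symm⟩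
      obtain ⟨lam, b, rfl⟩ : ∃ (y : Fin (M + 1) → ℂ) (v : ℂ), lam = Fin.snoc y v :=
        ⟨_, _, (Fin.snoc_init_self lam).symm⟩
      change Fin (M + 1) at j
      refine Fin.lastCases ?_ (fun j => ?_) j
      · obtain ⟨x, s, rfl⟩ : ∃ (y : Fin M → ℝ) (v : ℝ), x = Fin.snoc y v :=
          ⟨_, _, (Fin.snoc_init_self x).symm⟩
        obtain ⟨lam, a, rfl⟩ : ∃ (y : Fin M → ℂ) (v : ℂ), lam = Fin.snoc y v :=
          ⟨_, _, (Fin.snoc_init_self lam).symm⟩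
        have hl : leftPos (N := M + 2) (Fin.last M) = (Fin.last M).castSucc := rfl
        have hr : rightPos (N := M + 2) (Fin.last M) = Fin.last (M + 1) := rfl
        rw [snoc_snoc_comp_simpleSwap (M := M) x, snoc_snoc_comp_simpleSwap (M := M) lam, hl, hr]
        simpa [LastExchange] using ih.lastExchange x lam a b hlam s t
      · have hl : leftPos (N := M + 2) (Fin.castSucc (n := M) j)
          = (leftPos (N := M + 1) j).castSucc := rfl
        have hr : rightPos (N := M + 2) (Fin.castSucc (n := M) j)
          = (rightPos (N := M + 1) j).castSucc := rfl
        rw [snoc_comp_simpleSwap (M := M) x, snoc_comp_simpleSwap (M := M) lam, hl, hr,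
          Fin.snoc_castSucc, Fin.snoc_castSucc]
        exact ih.snoc (injective_of_snoc hlam) b j x t

/-! ### Identification with the pre-wavefunctions -/

theorem continuous_planeWave {N : ℕ} (lam : Fin N → ℂ) : Continuous (planeWave lam) := by
  unfold planeWave
  fun_prop

theorem permVec_inv_eq_comp {N : ℕ} (w : Equiv.Perm (Fin N)) (x : Fin N → ℝ) :
    permVec w⁻¹ x = x ∘ w := by
  funext k
  simp [permVec]

theorem planeWave_comp_perm {N : ℕ} (lam : Fin N → ℂ) (w : Equiv.Perm (Fin N)) (x : Fin N → ℝ) :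
    planeWave (lam ∘ w) (x ∘ w) = planeWave lam x := by
  simp only [planeWave, Function.comp_apply]
  rw [Equiv.sum_comp w fun j => lam j * (x j : ℂ)]

theorem planeWave_sub_smul {N : ℕ} (lam : Fin N → ℂ) (x : Fin N → ℝ) (l r : Fin N) (y : ℝ) :
    planeWave lam (x - y • (Pi.single l 1 - Pi.single r 1))
      = planeWave lam x * Complex.exp (-Complex.I * (lam l - lam r) * y) := by
  have h : ∑ j, lam j * (((x - y • (Pi.single l 1 - Pi.single r 1) : Fin N → ℝ) j : ℝ) : ℂ)
      = ∑ j, lam j * (x j : ℂ) - (lam l - lam r) * y := by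
    have : ∀ j, lam j * (((x - y • (Pi.single l 1 - Pi.single r 1) : Fin N → ℝ) j : ℝ) : ℂ)
        = lam j * (x j : ℂ) - y * (if j = l then lam j else 0) +
          y * (if j = r then lam j else 0) := fun j => by
      simp only [Pi.sub_apply, Pi.smul_apply, Pi.single_apply, smul_eq_mul]
      split_ifs <;> push_cast <;> ring
    simp only [this, Finset.sum_add_distrib, Finset.sum_sub_distrib, ← Finset.mul_sum,
      Finset.sum_ite_eq', Finset.mem_univ, if_true]
    ring
  rw [planeWave, planeWave, h, ← Complex.exp_add]
  ring_nf

theorem leftPos_ne_rightPos {N : ℕ} (j : Fin (N - 1)) : leftPos j ≠ rightPos j := by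
  simp [leftPos, rightPos, Fin.ext_iff]

theorem comp_simpleSwap_eq {N : ℕ} (x : Fin N → ℝ) (j : Fin (N - 1)) :
    x ∘ simpleSwap j = x - (x (leftPos j) - x (rightPos j)) •
      (Pi.single (leftPos j) 1 - Pi.single (rightPos j) 1) := by
  funext k
  have h := leftPos_ne_rightPos j
  simp only [Function.comp_apply, simpleSwap, Equiv.swap_apply_def, Pi.sub_apply, Pi.smul_apply,
    Pi.single_apply, smul_eq_mul]
  split_ifs with h₁ h₂ h₂
  · exact absurd (h₁.symm.trans h₂) h
  · rw [h₁]; ring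
  · rw [h₂]; ring
  · ring

theorem planeWave_comp_simpleSwap {N : ℕ} (lam : Fin N → ℂ) (j : Fin (N - 1)) (x : Fin N → ℝ) :
    planeWave (lam ∘ simpleSwap j) x = planeWave lam (x ∘ simpleSwap j) := by
  rw [← planeWave_comp_perm lam (simpleSwap j) (x ∘ simpleSwap j), Function.comp_assoc x,
    ← Equiv.Perm.coe_mul]
  simp [simpleSwap]

/-- Along e_j - e_{j+1} a plane wave is an exponential of frequency λ_j - λ_{j+1}; integrating it
leaves its two endpoint values, the plane wave and its transpose, with the coefficient of the
exchange relations. -/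
theorem deformedSwap_planeWave {N : ℕ} (γ : ℝ) (j : Fin (N - 1)) {lam : Fin N → ℂ}
    (hlam : Function.Injective lam) :
    deformedSwap γ j (planeWave lam) =
      (1 - exchangeCoeff γ (lam (leftPos j)) (lam (rightPos j))) • planeWave (lam ∘ simpleSwap j) +
      exchangeCoeff γ (lam (leftPos j)) (lam (rightPos j)) • planeWave lam := by
  funext x
  have hd : lam (leftPos j) - lam (rightPos j) ≠ 0 :=
    sub_ne_zero.2 (hlam.ne (leftPos_ne_rightPos j))
  have hc : -Complex.I * (lam (leftPos j) - lam (rightPos j)) ≠ 0 :=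
    mul_ne_zero (neg_ne_zero.2 Complex.I_ne_zero) hd
  have hI := Complex.I_mul_I
  simp only [deformedSwap, permFun, integralOp, Pi.add_apply, Pi.smul_apply, smul_eq_mul,
    planeWave_sub_smul]
  rw [permVec_inv_eq_comp, planeWave_comp_simpleSwap, comp_simpleSwap_eq, planeWave_sub_smul,
    intervalIntegral.integral_const_mul, integral_exp_mul_complex hc, exchangeCoeff]
  generalize Complex.exp (-Complex.I * (lam (leftPos j) - lam (rightPos j)) *
    ((x (leftPos j) - x (rightPos j) : ℝ) : ℂ)) = E
  simp only [Complex.ofReal_zero, mul_zero, Complex.exp_zero]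
  field_simp
  linear_combination (-planeWave lam x * γ * (E - 1)) * hI

theorem deformedSwap_add {N : ℕ} (γ : ℝ) (j : Fin (N - 1)) {f g : (Fin N → ℝ) → ℂ}
    (hf : Continuous f) (hg : Continuous g) :
    deformedSwap γ j (f + g) = deformedSwap γ j f + deformedSwap γ j g := by
  funext x
  have hl : Continuous fun y : ℝ =>
      x - y • (Pi.single (leftPos j) 1 - Pi.single (rightPos j) 1 : Fin N → ℝ) := by fun_prop
  simp only [deformedSwap, permFun, integralOp, Pi.add_apply]
  have := intervalIntegral_linear 1 1 (hf.comp hl) (hg.comp hl) 0 (x (leftPos j) - x (rightPos j))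
  simp only [one_mul, Function.comp_apply] at this
  rw [this]
  ring

theorem deformedSwap_smul {N : ℕ} (γ : ℝ) (j : Fin (N - 1)) (c : ℂ) (f : (Fin N → ℝ) → ℂ) :
    deformedSwap γ j (c • f) = c • deformedSwap γ j f := by
  funext x
  simp only [deformedSwap, permFun, integralOp, Pi.smul_apply, smul_eq_mul,
    intervalIntegral.integral_const_mul]
  ring

/-- The span of the pairs formed by a plane wave and the associated propagated function. -/
def wavePairs (γ : ℝ) (N : ℕ) : Submodule ℂ (((Fin N → ℝ) → ℂ) × ((Fin N → ℝ) → ℂ)) :=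
  Submodule.span ℂ {p | ∃ lam : Fin N → ℂ, Function.Injective lam ∧
    p = (planeWave lam, recWave γ N lam)}

theorem planeWave_mem_wavePairs (γ : ℝ) {N : ℕ} {lam : Fin N → ℂ} (h : Function.Injective lam) :
    (planeWave lam, recWave γ N lam) ∈ wavePairs γ N :=
  Submodule.subset_span ⟨lam, h, rfl⟩

theorem continuous_of_mem_wavePairs {γ : ℝ} {N : ℕ} {p : ((Fin N → ℝ) → ℂ) × ((Fin N → ℝ) → ℂ)}
    (hp : p ∈ wavePairs γ N) : Continuous p.1 := by
  induction hp using Submodule.span_induction with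
  | mem p hp =>
    obtain ⟨lam, _, rfl⟩ := hp
    exact continuous_planeWave lam
  | zero => exact continuous_const
  | add p q _ _ hp hq => exact hp.add hq
  | smul c p _ hp => exact hp.const_smul c

theorem eq_of_mem_wavePairs {γ : ℝ} {N : ℕ} {p : ((Fin N → ℝ) → ℂ) × ((Fin N → ℝ) → ℂ)}
    (hp : p ∈ wavePairs γ N) {x : Fin N → ℝ} (hx : Antitone x) : p.1 x = p.2 x := by
  induction hp using Submodule.span_induction with
  | mem p hp =>
    obtain ⟨lam, _, rfl⟩ := hp
    exact (recWave_of_antitone γ lam hx).symm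
  | zero => rfl
  | add p q _ _ hp hq => simp [hp, hq]
  | smul c p _ hp => simp [hp]

/-- On generators the two components transform with identical coefficients, by
`deformedSwap_planeWave` and by the exchange relations. -/
theorem deformedSwap_mem_wavePairs {γ : ℝ} {N : ℕ}
    {p : ((Fin N → ℝ) → ℂ) × ((Fin N → ℝ) → ℂ)} (hp : p ∈ wavePairs γ N) (j : Fin (N - 1)) :
    (deformedSwap γ j p.1, fun x => p.2 (x ∘ simpleSwap j)) ∈ wavePairs γ N := by
  induction hp using Submodule.span_induction with
  | mem p hp =>
    obtain ⟨lam, hlam, rfl⟩ := hp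
    have := Submodule.add_mem _
      (Submodule.smul_mem _ (1 - exchangeCoeff γ (lam (leftPos j)) (lam (rightPos j)))
        (planeWave_mem_wavePairs γ (hlam.comp (simpleSwap j).injective)))
      (Submodule.smul_mem _ (exchangeCoeff γ (lam (leftPos j)) (lam (rightPos j)))
        (planeWave_mem_wavePairs γ hlam))
    convert this using 1
    refine Prod.ext (deformedSwap_planeWave γ j hlam) (funext fun x => ?_)
    exact exchange γ N lam hlam j x
  | zero =>
    convert Submodule.zero_mem (wavePairs γ N) using 1
    refine Prod.ext ?_ rfl
    change deformedSwap γ j 0 = 0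
    have := deformedSwap_smul γ j 0 (0 : (Fin N → ℝ) → ℂ)
    rwa [zero_smul, zero_smul] at this
  | add p q hp' hq' hp hq =>
    have := Submodule.add_mem _ hp hq
    convert this using 1
    exact Prod.ext (deformedSwap_add γ j (continuous_of_mem_wavePairs hp')
      (continuous_of_mem_wavePairs hq')) rfl
  | smul c p _ hp =>
    have := Submodule.smul_mem _ c hp
    convert this using 1
    exact Prod.ext (deformedSwap_smul γ j c p.1) rfl

theorem deformedPerm_mem_wavePairs {γ : ℝ} {N : ℕ}
    {p : ((Fin N → ℝ) → ℂ) × ((Fin N → ℝ) → ℂ)} (hp : p ∈ wavePairs γ N)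
    (w : Equiv.Perm (Fin N)) :
    (deformedPerm γ w p.1, fun x => p.2 (x ∘ w)) ∈ wavePairs γ N := by
  -- The claim holds for every word, and the second component depends only on its product; the
  -- choice made by `word` is therefore immaterial.
  have h : ∀ l : List (Fin (N - 1)), (l.foldr (deformedSwap γ) p.1,
      fun x => p.2 (x ∘ (l.map simpleSwap).prod)) ∈ wavePairs γ N := by
    intro l
    induction l with
    | nil => exact hp
    | cons j l ih =>
      have := deformedSwap_mem_wavePairs ih j
      simpa [Function.comp_assoc] using this
  have hw : ((word w).map simpleSwap).prod = w := Classical.choose_spec (exists_word w)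
  have := h (word w)
  rwa [hw] at this

theorem exists_unique_permVec_mem {N : ℕ} {x : Fin N → ℝ} (hx : x ∈ regularVectors N) :
    ∃! w : Equiv.Perm (Fin N), permVec w x ∈ fundamentalAlcove N := by
  set σ := Tuple.sort fun k => -x k
  have hσ : StrictAnti (x ∘ σ) := by
    refine Antitone.strictAnti_of_injective (fun a b hab => ?_) (hx.comp σ.injective)
    exact neg_le_neg_iff.1 (Tuple.monotone_sort (fun k => -x k) hab)
  refine ⟨σ⁻¹, by simp only [permVec_inv_eq_comp]; exact hσ, fun w hw => ?_⟩
  have hw' : StrictAnti (x ∘ (w⁻¹ : Equiv.Perm (Fin N))) := by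
    rw [← permVec_inv_eq_comp, inv_inv]; exact hw
  have h := Tuple.unique_antitone hσ.antitone hw'.antitone
  rw [eq_inv_iff_mul_eq_one, mul_eq_one_iff_inv_eq]
  exact Equiv.ext fun k => (hx (congrFun h k)).symm

/-- Only the w that sorts x contributes. The sorted point lies in the chamber, where the two members
of a wave pair agree. -/
theorem propagation_planeWave (γ : ℝ) {N : ℕ} {lam : Fin N → ℂ} (hlam : Function.Injective lam)
    {x : Fin N → ℝ} (hx : x ∈ regularVectors N) :
    propagation γ (planeWave lam) x = recWave γ N lam x := by
  obtain ⟨w, hw, huniq⟩ := exists_unique_permVec_mem hx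
  rw [propagation, Finset.sum_eq_single w]
  · rw [Set.indicator_of_mem (by exact hw), permFun, inv_inv]
    have := eq_of_mem_wavePairs (deformedPerm_mem_wavePairs (planeWave_mem_wavePairs γ hlam) w)
      (StrictAnti.antitone hw)
    refine this.trans (congrArg (recWave γ N lam) ?_)
    funext k
    simp [permVec]
  · exact fun v _ hv => Set.indicator_of_notMem (fun h => hv (huniq v h)) _
  · exact fun h => absurd (Finset.mem_univ w) h

theorem dense_regularVectors (N : ℕ) : Dense (regularVectors N) := by
  intro x
  have hlim : Tendsto (fun ε : ℝ => x + ε • fun k : Fin N => ((k : ℕ) : ℝ)) (𝓝[≠] 0) (𝓝 x) := by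
    have : Continuous fun ε : ℝ => x + ε • fun k : Fin N => ((k : ℕ) : ℝ) := by fun_prop
    simpa using (this.tendsto 0).mono_left nhdsWithin_le_nhds
  refine mem_closure_of_tendsto hlim ?_
  have hne : ∀ c : ℝ, ∀ᶠ ε : ℝ in 𝓝[≠] 0, ε ≠ c := fun c => by
    rcases eq_or_ne c 0 with rfl | hc
    · exact self_mem_nhdsWithin
    · exact (eventually_ne_nhds hc.symm).filter_mono nhdsWithin_le_nhds
  -- Entries k ≠ l of x + ε(0, 1, 2, ...) collide for a single ε. For k = l the quotient is 0 by the
  -- convention on division, which the punctured neighbourhood already excludes.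
  filter_upwards [eventually_all.2 fun k : Fin N => eventually_all.2 fun l : Fin N =>
    hne ((x l - x k) / ((k : ℕ) - (l : ℕ)))] with ε hε k l hkl
  by_contra h
  have hd : (((k : ℕ) : ℝ) - ((l : ℕ) : ℝ)) ≠ 0 :=
    sub_ne_zero.2 fun h' => h (Fin.ext (by exact_mod_cast h'))
  refine hε k l ((eq_div_iff hd).2 ?_)
  simp only [Pi.add_apply, Pi.smul_apply, smul_eq_mul] at hkl
  linarith

theorem preWave_eq_recWave (γ : ℝ) {N : ℕ} {lam : Fin N → ℂ} (hlam : Function.Injective lam) :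
    preWave γ lam = recWave γ N lam := by
  funext x
  refine extendFrom_eq (dense_regularVectors N x) ?_
  refine ((continuous_recWave γ lam).continuousAt.tendsto.mono_left nhdsWithin_le_nhds).congr' ?_
  filter_upwards [self_mem_nhdsWithin] with y hy
  exact (propagation_planeWave γ hlam hy).symm

/-! ### Reflection -/

/-- The reflection `x ↦ (-x_n, ..., -x_1)`. -/
def reflect {R : Type*} [Neg R] {n : ℕ} (x : Fin n → R) : Fin n → R := fun k => -x k.rev

theorem reflect_reflect {R : Type*} [InvolutiveNeg R] {n : ℕ} (x : Fin n → R) :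
    reflect (reflect x) = x := by
  funext k
  simp [reflect]

theorem reflect_cons {R : Type*} [Neg R] {n : ℕ} (a : R) (x : Fin n → R) :
    reflect (Fin.cons a x : Fin (n + 1) → R) = Fin.snoc (reflect x) (-a) := by
  funext k
  refine Fin.lastCases ?_ (fun k => ?_) k
  · simp [reflect]
  · simp [reflect, Fin.rev_castSucc]

theorem reflect_snoc {R : Type*} [Neg R] {n : ℕ} (x : Fin n → R) (a : R) :
    reflect (Fin.snoc x a : Fin (n + 1) → R) = Fin.cons (-a) (reflect x) := by
  funext k
  refine Fin.cases ?_ (fun k => ?_) k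
  · simp [reflect]
  · simp [reflect, Fin.rev_succ]

theorem strictAnti_reflect {n : ℕ} {x : Fin n → ℝ} : StrictAnti (reflect x) ↔ StrictAnti x := by
  have h : ∀ x : Fin n → ℝ, StrictAnti x → StrictAnti (reflect x) := fun x hx a b hab =>
    neg_lt_neg (hx (Fin.rev_lt_rev.2 hab))
  exact ⟨fun hx => reflect_reflect x ▸ h _ hx, h x⟩

theorem stepFun_reflect {n : ℕ} (z : Fin n → ℝ) : stepFun (reflect z) = stepFun z := by
  simp only [stepFun, strictAnti_reflect]

theorem iterIntegral_reflect {n : ℕ} (lo hi : Fin n → ℝ) {F : (Fin n → ℝ) → ℂ}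
    (hF : Continuous F) :
    iterIntegral n lo hi F
      = iterIntegral n (reflect hi) (reflect lo) fun y => F (reflect y) := by
  rw [iterIntegral_comp_rev _ _ _ hF, iterIntegral_comp_neg]
  rfl

/-- The index tuple obtained by reflecting both the indices and their order. -/
def reflectEmb (N n : ℕ) : (Fin n ↪ Fin N) ≃ (Fin n ↪ Fin N) :=
  Equiv.embeddingCongr Fin.revPerm Fin.revPerm

theorem reflectEmb_apply {N n : ℕ} (i : Fin n ↪ Fin N) (m : Fin n) :
    reflectEmb N n i m = (i m.rev).rev := rfl

theorem reflect_replaceCoords {N n : ℕ} (i : Fin n ↪ Fin N) (y : Fin n → ℝ) (x : Fin N → ℝ) :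
    reflect (replaceCoords (reflectEmb N n i) y (reflect x)) = replaceCoords i (reflect y) x := by
  funext k
  by_cases h : ∃ m, i m = k
  · obtain ⟨m, rfl⟩ := h
    have hm : (i m).rev = reflectEmb N n i m.rev := by rw [reflectEmb_apply, Fin.rev_rev]
    rw [replaceCoords, replaceCoords, i.injective.extend_apply, reflect, hm,
      (reflectEmb N n i).injective.extend_apply, reflect]
  · rw [replaceCoords, replaceCoords, Function.extend_apply' _ _ _ h, reflect,
      Function.extend_apply', reflect, Fin.rev_rev, neg_neg]
    rintro ⟨m, hm⟩
    exact h ⟨m.rev, Fin.rev_injective hm⟩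

theorem kernelIntegral_reflect {N n : ℕ} (μ : ℂ) (i : Fin n ↪ Fin N) (lo hi : Fin n → ℝ)
    {f : (Fin N → ℝ) → ℂ} (hf : Continuous f) (x : Fin N → ℝ) :
    kernelIntegral μ i lo hi f x = kernelIntegral (-μ) (reflectEmb N n i) (reflect hi)
      (reflect lo) (fun v => f (reflect v)) (reflect x) := by
  rw [kernelIntegral, iterIntegral_reflect, kernelIntegral]
  · refine iterIntegral_congr fun y => ?_
    rw [reflect_replaceCoords]
    congr 1
    rw [← Equiv.prod_comp Fin.revPerm]
    refine Finset.prod_congr rfl fun m _ => ?_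
    simp only [Fin.revPerm_apply, reflect, reflectEmb_apply, Fin.rev_rev]
    push_cast
    ring_nf
  · exact Continuous.mul (by fun_prop) (hf.comp (continuous_replaceCoords i continuous_id
      continuous_const))

theorem withTop_reflect {n : ℕ} (z : Fin n → ℝ) (b : ℝ) :
    withTop (-b) (reflect z) = reflect (withBot z b) := (reflect_snoc z b).symm

theorem withTop_reflect_castSucc {n : ℕ} (z : Fin n → ℝ) (b : ℝ) :
    (fun m : Fin n => withTop (-b) (reflect z) m.castSucc)
      = reflect fun m => withBot z b m.succ := by
  funext m
  rw [withTop_reflect, reflect, reflect, Fin.rev_castSucc]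

/-- Reflection turns the bottom x_1 into the top -x_1, exchanges the bounds of each integral and
negates x - y, which is compensated by the sign of μ. -/
theorem bPlus_eq_bMinus {N : ℕ} (γ : ℝ) (μ : ℂ) {f : (Fin N → ℝ) → ℂ} (hf : Continuous f)
    (x : Fin (N + 1) → ℝ) :
    bPlus γ μ f x = bMinus γ (-μ) (fun v => f (reflect v)) (reflect x) := by
  refine Finset.sum_congr rfl fun n _ => congrArg _ ?_
  refine Fintype.sum_equiv (reflectEmb N n) _ _ fun i => ?_
  have h₁ : (Fin.init (reflect x) : Fin N → ℝ) = reflect (Fin.tail x) := by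
    funext k
    simp [Fin.init, reflect, Fin.tail, Fin.rev_castSucc]
  have h₂ : reflect x (Fin.last N) = -x 0 := by simp [reflect]
  have h₃ : (fun m => reflect (Fin.tail x) (reflectEmb N n i m))
      = reflect fun m => (Fin.tail x : Fin N → ℝ) (i m) := by
    funext m
    simp [reflect, reflectEmb_apply]
  simp only [eHatPlus, eHatMinus]
  rw [h₁, h₂, h₃, kernelIntegral_reflect μ i _ _ hf, withTop_reflect_castSucc, withTop_reflect,
    stepFun_reflect]
  push_cast
  ring_nf

theorem aOp_eq_dOp {N : ℕ} (γ L : ℝ) (μ : ℂ) {f : (Fin N → ℝ) → ℂ} (hf : Continuous f)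
    (x : Fin N → ℝ) :
    aOp γ L μ f x = dOp γ L (-μ) (fun v => f (reflect v)) (reflect x) := by
  refine Finset.sum_congr rfl fun n _ => congrArg _ ?_
  refine Fintype.sum_equiv (reflectEmb N n) _ _ fun i => ?_
  have h₃ : (fun m => reflect x (reflectEmb N n i m)) = reflect fun m => x (i m) := by
    funext m
    simp [reflect, reflectEmb_apply]
  have h₄ : L / 2 = -(-L / 2) := by ring
  simp only [eBarPlus, eBarMinus]
  rw [h₃, kernelIntegral_reflect μ i _ _ hf, h₄, withTop_reflect_castSucc, stepFun_reflect]
  ring_nf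

theorem exists_reflect_simpleSwap {N : ℕ} (j : Fin (N - 1)) :
    ∃ j' : Fin (N - 1), leftPos j' = (rightPos j).rev ∧ rightPos j' = (leftPos j).rev := by
  refine ⟨⟨N - 2 - j, by omega⟩, ?_, ?_⟩ <;> ext <;> simp [leftPos, rightPos, Fin.rev] <;> omega

theorem reflect_comp_simpleSwap {R : Type*} [Neg R] {N : ℕ} {j j' : Fin (N - 1)}
    (hl : leftPos j' = (rightPos j).rev) (hr : rightPos j' = (leftPos j).rev) (x : Fin N → R) :
    reflect (x ∘ simpleSwap j) = reflect x ∘ simpleSwap j' := by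
  funext k
  simp only [reflect, Function.comp_apply, simpleSwap, hl, hr]
  rw [Fin.rev_injective.map_swap, Fin.rev_rev, Fin.rev_rev, Equiv.swap_comm]

theorem planeWave_reflect {N : ℕ} (lam : Fin N → ℂ) (x : Fin N → ℝ) :
    planeWave lam (reflect x) = planeWave (reflect lam) x := by
  rw [planeWave, planeWave, ← Equiv.sum_comp Fin.revPerm]
  simp [reflect]

theorem reflect_injective {N : ℕ} {lam : Fin N → ℂ} (h : Function.Injective lam) :
    Function.Injective (reflect lam) :=
  fun _ _ hab => Fin.rev_injective (h (neg_injective hab))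

/-- `recWave` is built from one end only, so this symmetry is not visible in its definition. Both
sides agree on the chamber and obey the same exchange relations: reflection swaps and negates two
adjacent parameters, which preserves their difference. -/
theorem recWave_reflect (γ : ℝ) {N : ℕ} (x : Fin N → ℝ) : ∀ {lam : Fin N → ℂ},
    Function.Injective lam → recWave γ N lam (reflect x) = recWave γ N (reflect lam) x := by
  induction x using induction_of_antitone with
  | h0 x hx =>
    intro lam _
    have hx' : Antitone (reflect x) := fun a b hab => neg_le_neg (hx (Fin.rev_le_rev.2 hab))
    rw [recWave_of_antitone γ lam hx', recWave_of_antitone γ _ hx, planeWave_reflect]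
  | h1 x j ih =>
    intro lam hlam
    obtain ⟨j', hl, hr⟩ := exists_reflect_simpleSwap j
    have hl' : leftPos j = (rightPos j').rev := by rw [hr, Fin.rev_rev]
    have hr' : rightPos j = (leftPos j').rev := by rw [hl, Fin.rev_rev]
    have hc : exchangeCoeff γ (reflect lam (leftPos j)) (reflect lam (rightPos j))
        = exchangeCoeff γ (lam (leftPos j')) (lam (rightPos j')) := by
      simp only [exchangeCoeff, reflect, hl, hr]
      ring_nf
    rw [reflect_comp_simpleSwap hl hr, exchange γ N lam hlam j', ih hlam,
      ih (hlam.comp (simpleSwap j').injective), reflect_comp_simpleSwap hl' hr',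
      exchange γ N _ (reflect_injective hlam) j, hc]

/-! ### Asymptotics -/

theorem norm_planeWave {N : ℕ} {lam : Fin N → ℂ} (hre : ∀ k, (lam k).im = 0) (x : Fin N → ℝ) :
    ‖planeWave lam x‖ = 1 := by
  rw [planeWave, Complex.norm_exp]
  simp [hre]

/-- On the chamber real frequencies give modulus 1. The exchange relations transport a bound to each
of the finitely many other chambers. -/
theorem exists_norm_recWave_le (γ : ℝ) {N : ℕ} {lam : Fin N → ℂ} (hlam : Function.Injective lam)
    (hre : ∀ k, (lam k).im = 0) : ∃ C, ∀ x, ‖recWave γ N lam x‖ ≤ C := by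
  have h : ∀ (l : List (Fin (N - 1))) (lam : Fin N → ℂ), Function.Injective lam →
      (∀ k, (lam k).im = 0) →
      ∃ C, ∀ x, Antitone x → ‖recWave γ N lam (x ∘ (l.map simpleSwap).prod)‖ ≤ C := by
    intro l
    -- The word is shortened from the right because the exchange relation removes the transposition
    -- composed last with the point.
    induction l using List.reverseRecOn with
    | nil =>
      intro lam _ hre
      exact ⟨1, fun x hx => by
        simpa using (recWave_of_antitone γ lam hx ▸ norm_planeWave hre x).le⟩
    | append_singleton l j ih =>
      intro lam hlam hre
      obtain ⟨C₁, h₁⟩ := ih lam hlam hre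
      obtain ⟨C₂, h₂⟩ := ih _ (hlam.comp (simpleSwap j).injective) fun k => hre _
      set c := exchangeCoeff γ (lam (leftPos j)) (lam (rightPos j)) with hc
      refine ⟨‖1 - c‖ * C₂ + ‖c‖ * C₁, fun x hx => ?_⟩
      rw [List.map_append, List.prod_append, List.map_singleton, List.prod_singleton,
        Equiv.Perm.coe_mul, ← Function.comp_assoc, exchange γ N lam hlam j]
      refine (norm_add_le _ _).trans (add_le_add ?_ ?_)
      · rw [norm_mul]
        exact mul_le_mul_of_nonneg_left (h₂ x hx) (norm_nonneg _)
      · rw [norm_mul]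
        exact mul_le_mul_of_nonneg_left (h₁ x hx) (norm_nonneg _)
  have h' : ∀ w : Equiv.Perm (Fin N), ∃ C, ∀ x, Antitone x → ‖recWave γ N lam (x ∘ w)‖ ≤ C := by
    intro w
    obtain ⟨l, rfl⟩ := exists_word w
    exact h l lam hlam hre
  choose C hC using h'
  refine ⟨∑ w, |C w|, fun x => ?_⟩
  set σ := Tuple.sort fun k => -x k
  have hσ : Antitone (x ∘ σ) := fun a b hab =>
    neg_le_neg_iff.1 (Tuple.monotone_sort (fun k => -x k) hab)
  have h₁ := hC σ⁻¹ _ hσ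
  rw [Function.comp_assoc, ← Equiv.Perm.coe_mul, mul_inv_cancel, Equiv.Perm.coe_one,
    Function.comp_id] at h₁
  exact h₁.trans ((le_abs_self _).trans
    (Finset.single_le_sum (fun w _ => abs_nonneg (C w)) (Finset.mem_univ _)))

theorem tauMinus_comp {N : ℕ} (γ : ℝ) (μ : ℂ) (lam : Fin N → ℂ) (w : Equiv.Perm (Fin N)) :
    tauMinus γ μ (lam ∘ w) = tauMinus γ μ lam :=
  Equiv.prod_comp w fun j => (lam j - μ + Complex.I * (γ : ℂ)) / (lam j - μ)

theorem tauMinus_snoc {N : ℕ} (γ : ℝ) (μ : ℂ) (lam : Fin N → ℂ) (κ : ℂ) :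
    tauMinus γ μ (Fin.snoc lam κ : Fin (N + 1) → ℂ)
      = tauMinus γ μ lam * ((κ - μ + Complex.I * (γ : ℂ)) / (κ - μ)) := by
  simp only [tauMinus, Fin.prod_univ_castSucc, Fin.snoc_castSucc, Fin.snoc_last]

theorem tauMinus_reflect {N : ℕ} (γ : ℝ) (μ : ℂ) (lam : Fin N → ℂ) :
    tauMinus γ (-μ) (reflect lam) = tauPlus γ μ lam := by
  rw [tauMinus, tauPlus, ← Equiv.prod_comp Fin.revPerm]
  refine Finset.prod_congr rfl fun j _ => ?_
  simp only [reflect, Fin.revPerm_apply, Fin.rev_rev]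
  rw [← neg_div_neg_eq]
  ring_nf

theorem ne_of_im {κ μ : ℂ} (hκ : κ.im = 0) (hμ : μ.im < 0) : κ ≠ μ := by
  rintro rfl
  exact hμ.ne hκ

/-- For decreasing x with lowest entry u, the two-step formula gives two terms. One is the same
problem with u removed, weighted by 1 - c = (κ - μ + iγ)/(κ - μ), a factor of τ^-; the other is
bounded times e^{-iμt}, of modulus e^{t Im μ}, and dies out. Other x follow from the exchange
relations, since τ^- is symmetric in λ. -/
theorem tendsto_recWave_snoc (γ : ℝ) {μ : ℂ} (hμ : μ.im < 0) {N : ℕ} : ∀ (x : Fin N → ℝ)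
    (lam : Fin N → ℂ), Function.Injective lam → (∀ k, (lam k).im = 0) →
    Tendsto (fun t : ℝ => Complex.exp (-Complex.I * μ * t) *
        recWave γ (N + 1) (Fin.snoc lam μ) (Fin.snoc x t)) atTop
      (𝓝 (tauMinus γ μ lam * recWave γ N lam x)) := by
  induction N with
  | zero =>
    intro x lam _ _
    refine tendsto_const_nhds.congr fun t => ?_
    rw [recWave_snoc_of_le _ _ _ _ _ fun k => k.elim0, ← mul_assoc, ← Complex.exp_add]
    simp [tauMinus]
  | succ N ihN =>
    intro x
    induction x using induction_of_antitone with
    | h0 x hx =>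
      intro lam hlam hre
      obtain ⟨x, u, rfl⟩ : ∃ (y : Fin N → ℝ) (v : ℝ), x = Fin.snoc y v :=
        ⟨_, _, (Fin.snoc_init_self x).symm⟩
      obtain ⟨lam, κ, rfl⟩ : ∃ (y : Fin N → ℂ) (v : ℂ), lam = Fin.snoc y v :=
        ⟨_, _, (Fin.snoc_init_self lam).symm⟩
      have hκ : κ.im = 0 := by simpa using hre (Fin.last N)
      have hκμ := ne_of_im hκ hμ
      have hxu : ∀ k, u ≤ x k := fun k => by simpa using hx (Fin.le_last k.castSucc)
      obtain ⟨C, hC⟩ := exists_norm_recWave_le γ hlam hre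
      have hzero : Tendsto (fun t : ℝ => Complex.exp (-Complex.I * μ * t) *
          recWave γ (N + 1) (Fin.snoc lam κ) (Fin.snoc x t)) atTop (𝓝 0) := by
        have hexp : Tendsto (fun t : ℝ => Real.exp (μ.im * t) * C) atTop (𝓝 0) := by
          have : Tendsto (fun t : ℝ => μ.im * t) atTop atBot :=
            tendsto_id.const_mul_atTop_of_neg hμ
          simpa using (Real.tendsto_exp_atBot.comp this).mul_const C
        refine squeeze_zero_norm (fun t => ?_) hexp
        rw [norm_mul, Complex.norm_exp]
        refine mul_le_mul (le_of_eq ?_) (hC _) (norm_nonneg _) (Real.exp_nonneg _)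
        simp
      have hmain := ihN x lam (injective_of_snoc hlam) fun k => by simpa using hre k.castSucc
      have hlim := (hmain.const_mul ((1 - exchangeCoeff γ κ μ) *
        Complex.exp (Complex.I * κ * u))).add
        (hzero.const_mul (exchangeCoeff γ κ μ * Complex.exp (Complex.I * μ * u)))
      have hval : tauMinus γ μ (Fin.snoc lam κ : Fin (N + 1) → ℂ) *
          recWave γ (N + 1) (Fin.snoc lam κ) (Fin.snoc x u)
          = (1 - exchangeCoeff γ κ μ) * Complex.exp (Complex.I * κ * u) *
            (tauMinus γ μ lam * recWave γ N lam x) +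
            exchangeCoeff γ κ μ * Complex.exp (Complex.I * μ * u) * 0 := by
        have hd : κ - μ ≠ 0 := sub_ne_zero.2 hκμ
        rw [tauMinus_snoc, recWave_snoc_of_le _ _ _ _ _ hxu, exchangeCoeff]
        field_simp
        ring
      rw [hval]
      refine hlim.congr' ?_
      filter_upwards [eventually_ge_atTop u] with t ht
      rw [recWave_snoc_snoc_of_le γ hκμ x u t hxu ht]
      ring
    | h1 x j ih =>
      intro lam hlam hre
      have hlim := ((ih _ (hlam.comp (simpleSwap j).injective) fun k => hre _).const_mul
        (1 - exchangeCoeff γ (lam (leftPos j)) (lam (rightPos j)))).add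
        ((ih lam hlam hre).const_mul (exchangeCoeff γ (lam (leftPos j)) (lam (rightPos j))))
      rw [exchange γ _ lam hlam j x]
      rw [tauMinus_comp] at hlim
      convert hlim using 2 with t
      · rw [(exchange γ _).snoc hlam]
        ring
      · ring

/-- With L/2 above all coordinates, the extra inequality L/2 > z_1 in θ is automatic. -/
theorem dOp_eq_bMinus {N : ℕ} (γ L : ℝ) (μ : ℂ) (f : (Fin N → ℝ) → ℂ) (x : Fin N → ℝ)
    (h : ∀ k, x k < L / 2) : dOp γ L μ f x = bMinus γ μ f (Fin.snoc x (L / 2)) := by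
  refine Finset.sum_congr rfl fun n _ => congrArg _ (Finset.sum_congr rfl fun i _ => ?_)
  have hs : StrictAnti (withTop (L / 2) fun m => x (i m)) ↔ StrictAnti fun m => x (i m) := by
    refine ⟨fun hs a b hab => by simpa [withTop] using hs (Fin.succ_lt_succ_iff.2 hab),
      fun hs a b hab => ?_⟩
    induction a using Fin.cases with
    | zero =>
      obtain ⟨b, rfl⟩ := Fin.exists_succ_eq.2 hab.ne'
      simpa [withTop] using h _
    | succ a =>
      obtain ⟨b, rfl⟩ := Fin.exists_succ_eq.2 ((Fin.succ_pos a).trans hab).ne'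
      simpa [withTop] using hs (Fin.succ_lt_succ_iff.1 hab)
  simp only [eBarMinus, eHatMinus, Fin.snoc_last, Fin.init_snoc, stepFun, hs]
  push_cast
  ring_nf

theorem tendsto_dOp_recWave (γ : ℝ) {μ : ℂ} (hμ : μ.im < 0) {N : ℕ} (x : Fin N → ℝ)
    {lam : Fin N → ℂ} (hlam : Function.Injective lam) (hre : ∀ k, (lam k).im = 0) :
    Tendsto (fun L : ℝ => Complex.exp (-Complex.I * μ * (L : ℂ) / 2) *
        dOp γ L μ (recWave γ N lam) x) atTop (𝓝 (tauMinus γ μ lam * recWave γ N lam x)) := by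
  have hL : Tendsto (fun L : ℝ => L / 2) atTop atTop := tendsto_id.atTop_div_const two_pos
  refine ((tendsto_recWave_snoc γ hμ x lam hlam hre).comp hL).congr' ?_
  filter_upwards [eventually_all.2 fun k => hL.eventually_gt_atTop (x k)] with L h
  rw [dOp_eq_bMinus _ _ _ _ _ h, Function.comp_apply, recWave_snoc]
  push_cast
  ring_nf

/-- After reflection, b^-_{-μ} appends -μ to the reflected parameters, and the result is the
reflection of (μ, λ). -/
theorem bPlus_recWave (γ : ℝ) {N : ℕ} {lam : Fin N → ℂ} {μ : ℂ}
    (h : Function.Injective (Fin.cons μ lam : Fin (N + 1) → ℂ)) :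
    bPlus γ μ (recWave γ N lam) = recWave γ (N + 1) (Fin.cons μ lam) := by
  funext x
  have hlam : Function.Injective lam := fun a b hab => Fin.succ_injective _ (h (by simpa using hab))
  rw [bPlus_eq_bMinus γ μ (continuous_recWave γ lam)]
  simp only [recWave_reflect γ _ hlam]
  rw [← recWave_snoc, ← reflect_cons, ← recWave_reflect γ _ h, reflect_reflect]

end QNLS

end

/-! ### The proposition -/

theorem mainTheorem12 (N : ℕ) (γ : ℝ) (lam : Fin N → ℝ) (hlam : lam ∈ QNLS.regularVectors N)
    (μ : ℂ) (hμ : ∀ j, μ ≠ (lam j : ℂ)) :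
    (QNLS.bMinus γ μ (QNLS.preWave γ fun j => (lam j : ℂ)) =
        QNLS.preWave γ (QNLS.appendLast (fun j => (lam j : ℂ)) μ) ∧
      Continuous (QNLS.preWave γ (QNLS.appendLast (fun j => (lam j : ℂ)) μ))) ∧
    (QNLS.bPlus γ μ (QNLS.preWave γ fun j => (lam j : ℂ)) =
        QNLS.preWave γ (QNLS.appendFirst μ fun j => (lam j : ℂ)) ∧
      Continuous (QNLS.preWave γ (QNLS.appendFirst μ fun j => (lam j : ℂ)))) ∧
    (0 < μ.im → ∀ x : Fin N → ℝ,
      Tendsto (fun L : ℝ => Complex.exp (Complex.I * μ * (L : ℂ) / 2) *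
          QNLS.aOp γ L μ (QNLS.preWave γ fun j => (lam j : ℂ)) x) atTop
        (𝓝 (QNLS.tauPlus γ μ (fun j => (lam j : ℂ)) *
          QNLS.preWave γ (fun j => (lam j : ℂ)) x))) ∧
    (μ.im < 0 → ∀ x : Fin N → ℝ,
      Tendsto (fun L : ℝ => Complex.exp (-Complex.I * μ * (L : ℂ) / 2) *
          QNLS.dOp γ L μ (QNLS.preWave γ fun j => (lam j : ℂ)) x) atTop
        (𝓝 (QNLS.tauMinus γ μ (fun j => (lam j : ℂ)) *
          QNLS.preWave γ (fun j => (lam j : ℂ)) x))) := by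
  have hinj : Function.Injective fun j => (lam j : ℂ) := Complex.ofReal_injective.comp hlam
  have hre : ∀ j, ((lam j : ℂ)).im = 0 := fun j => Complex.ofReal_im _
  have hμ' : μ ∉ Set.range fun j => (lam j : ℂ) := fun ⟨j, hj⟩ => hμ j hj.symm
  have hlast : Function.Injective (Fin.snoc (fun j => (lam j : ℂ)) μ : Fin (N + 1) → ℂ) :=
    Fin.snoc_injective_iff.2 ⟨hinj, hμ'⟩
  have hfirst : Function.Injective (Fin.cons μ fun j => (lam j : ℂ) : Fin (N + 1) → ℂ) :=
    Fin.cons_injective_iff.2 ⟨hμ', hinj⟩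
  rw [QNLS.preWave_eq_recWave γ hinj, QNLS.appendLast, QNLS.appendFirst,
    QNLS.preWave_eq_recWave γ hlast, QNLS.preWave_eq_recWave γ hfirst]
  refine ⟨⟨(QNLS.recWave_snoc _ _ _).symm, QNLS.continuous_recWave _ _⟩,
    ⟨QNLS.bPlus_recWave γ hfirst, QNLS.continuous_recWave _ _⟩, fun him x => ?_,
    fun him x => QNLS.tendsto_dOp_recWave γ him x hinj hre⟩
  -- The limit for a_μ is the limit for d_{-μ} at the reflected point with reflected parameters; Im
  -- μ > 0 becomes Im(-μ) < 0 and τ^- becomes τ^+.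
  have h := QNLS.tendsto_dOp_recWave γ (μ := -μ) (by simpa using him) (QNLS.reflect x)
    (QNLS.reflect_injective hinj) fun k => by simp [QNLS.reflect]
  rw [QNLS.tauMinus_reflect, ← QNLS.recWave_reflect γ _ hinj, QNLS.reflect_reflect] at h
  refine h.congr fun L => ?_
  rw [QNLS.aOp_eq_dOp γ L μ (QNLS.continuous_recWave γ _)]
  simp only [QNLS.recWave_reflect γ _ hinj]
  ring_nf
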